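/- **Model.** There are $N$ servers with service rates $\mu_1,\dots,\mu_N>0$, $\mu_\Sigma=\sum_n\mu_n$, and one dispatcher, in slotted time. In slot $t$, $A_\Sigma(t)$ jobs arrive and server $n$ offers service $S_n(t)$; all are nonnegative integers, i.i.d. over time, mutually independent and bounded by constants ($A_\Sigma(t)\le A_{\max}$, $S_n(t)\le S_{\max}$), with $\mathbb E S_n(t)=\mu_n$ and, in the system with parameter $\epsilon>0$, $\mathbb E A_\Sigma(t)=\mu_\Sigma-\epsilon$; the services do not depend on $\epsilon$. The state is $Z(t)=(Q(t),m(t))$, with $Q(t)\in\mathbb N^N$ the queue lengths and $m(t)\subseteq\{1,\dots,N\}$ the memory of the dispatcher. A load-balancing policy sends all arrivals of slot $t$ to a single queue, which is $n$ with conditional probability $p_n(t)$, a function of $t$ and $Z(t)$ (given $Z(t)$, the choice is independent of the arrivals and services of the slot). With $A_n(t)=A_\Sigma(t)$ for the chosen queue and $A_n(t)=0$ otherwise, $Q_n(t+1)=\max(Q_n(t)+A_n(t)-S_n(t),0)$. The new memory is drawn from a law determined by $t$, $Z(t)$, the chosen server, $A_\Sigma(t)$ and $(S_n(t))_n$. The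 rule may depend on $\epsilon$; the set of possible values of $Z(t)$ is part of the policy. **Class $\Pi$.** Given a state, let $\sigma$ be a permutation with $Q_{\sigma(1)}\le\dots\le Q_{\sigma(N)}$. For a probability vector $P$ put $\Delta_n=P_n-\mu_{\sigma(n)}/\mu_\Sigma$. $P$ is *tilted* if for some $k\in\{2,\dots,N\}$, $\Delta_n\ge0$ for all $n<k$ and $\Delta_n\le0$ for all $n\ge k$; it is *$\delta$-tilted* if moreover $\Delta_1\ge\delta$ and $\Delta_N\le-\delta$. Two probability vectors $P,\hat P$ are *equivalent in inner product* if $\sum_nQ_{\sigma(n)}P_n=\sum_nQ_{\sigma(n)}\hat P_n$. Let $P_n(t)=p_{\sigma(n)}(t)$. A policy is in $\Pi$ if 1. for all $t\ge0$ and all possible values of $Z(t)$, $P(t)$ or a probability vector equivalent to it in inner product is tilted (for some sorting permutation $\sigma$); and 2. there are a positive integer $T$ and a $\delta>0$, both independent of $\epsilon$, such that every window $\{kT,\dots,(k+1)T-1\}$, $k\in\mathbb N$, contains a slot $t_k$ such that for all possible values of $Z(t_k)$, $P(t_k)$ or a probability vector equivalent to it in inner product is $\delta$-tilted (for some sorting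 permutation $\sigma$). **Theorem.** Every policy in $\Pi$ is throughput optimal and heavy-traffic delay optimal, that is: * *(Throughput optimality)* for every $\epsilon>0$, all arrival and service laws as above and every initial law on the possible initial states, $$\limsup_{C\to\infty}\limsup_{t\to\infty}\mathbb P\Big(\sum_nQ_n(t)>C\Big)=0.$$ * *(Heavy-traffic delay optimality)* for all service laws as above, all families of arrival laws as above, $0<\epsilon<\epsilon_0$, with $A_{\max}$ independent of $\epsilon$ and with $\mathrm{Var}(A_\Sigma^{(\epsilon)}(t))$ converging to a constant as $\epsilon\downarrow0$, and all initial laws: let $q^{(\epsilon)}$ be the resource-pooled single-server queue, $q(t+1)=\max(q(t)+A_\Sigma(t)-\sum_nS_n(t),0)$. Then steady-state distributions of $Q^{(\epsilon)}$ and of $q^{(\epsilon)}$ exist, and for any choice of them the mean total queue lengths are finite and, as $\epsilon\downarrow0$, $\epsilon\,\mathbb E\big[\sum_n\overline Q_n^{(\epsilon)}\big]$ and $\epsilon\,\mathbb E\big[\overline q^{(\epsilon)}\big]$ converge to the same finite limit. Here a steady-state distribution of a process $X(t)$ on a countable space is a probability law that is a limit point, as $t\to\infty$, of the time averages $\frac1t\sum_{s<t}\mathbb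 P(X(s)\in\cdot)$ (if $X(t)$ converges in distribution, or is stationary, it is the limit law, respectively the stationary law). -/

import Mathlib

open Filter Topology MeasureTheory ProbabilityTheory

/-! ### The stochastic primitives -/

/-- Mean of a law on `ℕ` (only used for laws with bounded support). -/
noncomputable def pmfMean (ν : PMF ℕ) : ℝ := ∫ k, (k : ℝ) ∂ν.toMeasure

/-- Variance of a law on `ℕ` (only used for laws with bounded support). -/
noncomputable def pmfVar (ν : PMF ℕ) : ℝ := variance (fun k : ℕ => (k : ℝ)) ν.toMeasure

/-- A random variable with law `ν` is almost surely at most `B`. -/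
def BoundedBy (ν : PMF ℕ) (B : ℕ) : Prop := ∀ k ∈ ν.support, k ≤ B

/-- The law of `(S_1, …, S_N)` when the `S_n` are independent with laws `svc n`. -/
noncomputable def serviceLaw {N : ℕ} (svc : Fin N → PMF ℕ) : PMF (Fin N → ℕ) :=
  (Measure.pi fun n => (svc n).toMeasure).toPMF

/-- Assumption on the services: `S_n(t)` has mean `μ n`, and all services are bounded by one
constant. (Independence over servers and over time is built into the dynamics below.) -/
structure IsServiceProcess {N : ℕ} (μ : Fin N → ℝ) (svc : Fin N → PMF ℕ) : Prop where
  mean_eq : ∀ n, pmfMean (svc n) = μ n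
  bounded : ∃ Smax : ℕ, ∀ n, BoundedBy (svc n) Smax

/-! ### Load balancing policies and the dynamics -/

/-- A state `Z = (Q, m)`: the queue lengths and the set of server IDs stored at the dispatcher. -/
abbrev State (N : ℕ) := (Fin N → ℕ) × Finset (Fin N)

/-- Queue dynamics `Q_i(t+1) = [Q_i(t) + A_i(t) - S_i(t)]^+`, where all `a` arrivals are routed to
server `n`. The subtraction is the truncated subtraction of natural numbers. -/
def nextQueue {N : ℕ} (q : Fin N → ℕ) (n : Fin N) (a : ℕ) (s : Fin N → ℕ) : Fin N → ℕ :=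
  fun i => (q i + if i = n then a else 0) - s i

/-- A dispatching rule. In slot `t` and state `z`, the arrivals of the slot are sent to server `n`
with probability `dispatch t z n`. If server `n` was selected, `a` jobs have arrived and `s` is the
vector of offered services, then the new content of the memory has law `update t z n a s`.
The set `states t` contains the possible values of `Z(t)`. -/
structure DispatchRule (N : ℕ) where
  states : ℕ → Set (State N)
  dispatch : ℕ → State N → PMF (Fin N)
  update : ℕ → State N → Fin N → ℕ → (Fin N → ℕ) → PMF (Finset (Fin N))
  states_nonempty : (states 0).Nonempty
  states_closed : ∀ t, ∀ z ∈ states t, ∀ n ∈ (dispatch t z).support, ∀ a s,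
    ∀ m ∈ (update t z n a s).support, (nextQueue z.1 n a s, m) ∈ states (t + 1)

/-- A load balancing policy: the dispatching rule that is used in the system with parameter `ε`
(for many policies it does not depend on `ε`). -/
abbrev Policy (N : ℕ) := ℝ → DispatchRule N

/-- One slot of the chain `Z(t)`: the arrivals, the services and the selected server are independent
given `Z(t)`. -/
noncomputable def stepLaw {N : ℕ} (R : DispatchRule N) (arr : PMF ℕ) (svc : Fin N → PMF ℕ)
    (t : ℕ) (z : State N) : PMF (State N) :=
  arr.bind fun a => (serviceLaw svc).bind fun s => (R.dispatch t z).bind fun n =>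
    (R.update t z n a s).map fun m => (nextQueue z.1 n a s, m)

/-- The law of `Z(t)` when `Z(0)` has law `init`. -/
noncomputable def stateLaw {N : ℕ} (R : DispatchRule N) (arr : PMF ℕ) (svc : Fin N → PMF ℕ)
    (init : PMF (State N)) : ℕ → PMF (State N)
  | 0 => init
  | t + 1 => (stateLaw R arr svc init t).bind (stepLaw R arr svc t)

/-- The law of the queue length vector `Q(t)`. -/
noncomputable def queueLaw {N : ℕ} (R : DispatchRule N) (arr : PMF ℕ) (svc : Fin N → PMF ℕ)
    (init : PMF (State N)) (t : ℕ) : PMF (Fin N → ℕ) :=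
  (stateLaw R arr svc init t).map Prod.fst

/-- The law of the queue length `q(t)` of the resource-pooled system: a single server queue with
arrivals `A_Σ(t)` and services `∑ n, S_n(t)`. -/
noncomputable def pooledLaw {N : ℕ} (arr : PMF ℕ) (svc : Fin N → PMF ℕ) (init : PMF ℕ) :
    ℕ → PMF ℕ
  | 0 => init
  | t + 1 => (pooledLaw arr svc init t).bind fun q =>
      arr.bind fun a => (serviceLaw svc).map fun s => q + a - ∑ n, s n

/-! ### Tilted distributions and the class `Π` -/

/-- `P_n = p_{σ(n)}`. -/
noncomputable def sortedProb {N : ℕ} (σ : Equiv.Perm (Fin N)) (p : PMF (Fin N)) : Fin N → ℝ :=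
  fun n => (p (σ n)).toReal

/-- `Δ_n = P_n - μ_{σ(n)} / μ_Σ`. -/
noncomputable def tiltGap {N : ℕ} (μ : Fin N → ℝ) (σ : Equiv.Perm (Fin N)) (P : Fin N → ℝ) :
    Fin N → ℝ :=
  fun n => P n - μ (σ n) / ∑ i, μ i

/-- `P` is tilted. The server position `n` of the (one-based) definition is `n.val + 1` here. -/
def IsTilted {N : ℕ} (μ : Fin N → ℝ) (σ : Equiv.Perm (Fin N)) (P : Fin N → ℝ) : Prop :=
  ∃ k : ℕ, 2 ≤ k ∧ k ≤ N ∧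
    (∀ n : Fin N, n.val + 1 < k → 0 ≤ tiltGap μ σ P n) ∧
    (∀ n : Fin N, k ≤ n.val + 1 → tiltGap μ σ P n ≤ 0)

/-- `P` is `δ`-tilted: it is tilted, `Δ_1 ≥ δ` and `Δ_N ≤ -δ`. -/
def IsDeltaTilted {N : ℕ} (μ : Fin N → ℝ) (δ : ℝ) (σ : Equiv.Perm (Fin N)) (P : Fin N → ℝ) :
    Prop :=
  IsTilted μ σ P ∧
    (∀ n : Fin N, n.val + 1 = 1 → δ ≤ tiltGap μ σ P n) ∧
    (∀ n : Fin N, n.val + 1 = N → tiltGap μ σ P n ≤ -δ)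

/-- Equivalence in inner product of the dispatching distributions `P` and `P'` (both indexed by
the position in the order `σ`). -/
def InnerEquiv {N : ℕ} (q : Fin N → ℕ) (σ : Equiv.Perm (Fin N)) (P P' : Fin N → ℝ) : Prop :=
  ∑ n, (q (σ n) : ℝ) * P n = ∑ n, (q (σ n) : ℝ) * P' n

/-- For an order `σ` that sorts the queues, the dispatching distribution `p`, or one that is
equivalent to it in inner product, has the property `X σ`. -/
def HoldsUpToEquiv {N : ℕ} (X : Equiv.Perm (Fin N) → (Fin N → ℝ) → Prop) (q : Fin N → ℕ)
    (p : PMF (Fin N)) : Prop :=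
  ∃ σ : Equiv.Perm (Fin N), Monotone (fun n => q (σ n)) ∧
    ∃ P' ∈ stdSimplex ℝ (Fin N), InnerEquiv q σ (sortedProb σ p) P' ∧ X σ P'

/-- The class `Π` for servers with service rates `μ`. -/
structure InClassPi {N : ℕ} (μ : Fin N → ℝ) (pol : Policy N) : Prop where
  tilted : ∀ ε : ℝ, 0 < ε → ∀ t, ∀ z ∈ (pol ε).states t,
    HoldsUpToEquiv (IsTilted μ) z.1 ((pol ε).dispatch t z)
  deltaTilted : ∃ T : ℕ, 0 < T ∧ ∃ δ : ℝ, 0 < δ ∧ ∀ ε : ℝ, 0 < ε → ∀ k : ℕ,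
    ∃ t, k * T ≤ t ∧ t < (k + 1) * T ∧ ∀ z ∈ (pol ε).states t,
      HoldsUpToEquiv (IsDeltaTilted μ δ) z.1 ((pol ε).dispatch t z)

/-! ### Throughput optimality and heavy-traffic delay optimality -/

/-- Stability: `limsup_{C → ∞} limsup_{t → ∞} ℙ(∑ n, Q_n(t) > C) = 0`. -/
def IsStable {N : ℕ} (law : ℕ → PMF (Fin N → ℕ)) : Prop :=
  limsup (fun C : ℝ => limsup (fun t : ℕ =>
    (law t).toMeasure {q | C < ∑ n, (q n : ℝ)}) atTop) atTop = 0

/-- The policy stabilizes the system for all arrivals with rate `μ_Σ - ε`, `ε > 0`. -/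
def ThroughputOptimal {N : ℕ} (μ : Fin N → ℝ) (pol : Policy N) : Prop :=
  ∀ svc : Fin N → PMF ℕ, IsServiceProcess μ svc →
  ∀ ε : ℝ, 0 < ε →
  ∀ arr : PMF ℕ, pmfMean arr = ∑ n, μ n - ε → (∃ Amax : ℕ, BoundedBy arr Amax) →
  ∀ init : PMF (State N), init.support ⊆ (pol ε).states 0 →
    IsStable (queueLaw (pol ε) arr svc init)

/-- `π` is a steady-state distribution of a process on a countable space with one-dimensional laws
`law t`: a limit point of its long-run time averages. As the dynamics may depend on time, a limit
law need not exist. If `law t` converges to a probability law, then that law is the only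
steady-state distribution; if `law t` does not depend on `t` (a stationary process), then its
constant value is the only one. -/
def IsSteadyState {α : Type*} (law : ℕ → PMF α) (π : PMF α) : Prop :=
  ∃ φ : ℕ → ℕ, StrictMono φ ∧ ∀ x, Tendsto
    (fun k => (∑ t ∈ Finset.range (φ k), (law t x).toReal) / (φ k : ℝ)) atTop (𝓝 (π x).toReal)

/-- Heavy-traffic delay optimality. For all services with rates `μ` and all arrivals with
rate `μ_Σ - ε`, with a bound `Amax` not depending on `ε` and with converging variances: the
load-balancing and the resource-pooled systems have steady-state distributions; each of these has a
finite mean total queue length; and the means multiplied by `ε` have the same finite limit. -/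
def HeavyTrafficDelayOptimal {N : ℕ} (μ : Fin N → ℝ) (pol : Policy N) : Prop :=
  ∀ svc : Fin N → PMF ℕ, IsServiceProcess μ svc →
  ∀ (ε₀ : ℝ) (arr : ℝ → PMF ℕ) (Amax : ℕ) (σsq : ℝ), 0 < ε₀ →
  (∀ ε ∈ Set.Ioo 0 ε₀, pmfMean (arr ε) = ∑ n, μ n - ε) →
  (∀ ε ∈ Set.Ioo 0 ε₀, BoundedBy (arr ε) Amax) →
  Tendsto (fun ε => pmfVar (arr ε)) (𝓝[>] 0) (𝓝 σsq) →
  ∀ (init : ℝ → PMF (State N)) (init' : ℝ → PMF ℕ),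
  (∀ ε ∈ Set.Ioo 0 ε₀, (init ε).support ⊆ (pol ε).states 0) →
    (∀ ε ∈ Set.Ioo 0 ε₀,
      (∃ π, IsSteadyState (queueLaw (pol ε) (arr ε) svc (init ε)) π) ∧
      (∃ π', IsSteadyState (pooledLaw (arr ε) svc (init' ε)) π')) ∧
    ∀ (π : ℝ → PMF (Fin N → ℕ)) (π' : ℝ → PMF ℕ),
      (∀ ε ∈ Set.Ioo 0 ε₀, IsSteadyState (queueLaw (pol ε) (arr ε) svc (init ε)) (π ε)) →
      (∀ ε ∈ Set.Ioo 0 ε₀, IsSteadyState (pooledLaw (arr ε) svc (init' ε)) (π' ε)) →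
      (∀ ε ∈ Set.Ioo 0 ε₀,
        Integrable (fun q : Fin N → ℕ => ∑ n, (q n : ℝ)) (π ε).toMeasure ∧
        Integrable (fun q : ℕ => (q : ℝ)) (π' ε).toMeasure) ∧
      ∃ L : ℝ,
        Tendsto (fun ε => ε * ∫ q, ∑ n, (q n : ℝ) ∂(π ε).toMeasure) (𝓝[>] 0) (𝓝 L) ∧
        Tendsto (fun ε => ε * ∫ q, (q : ℝ) ∂(π' ε).toMeasure) (𝓝[>] 0) (𝓝 L)

/-! Write X for the total queue length, Q_⊥ for the deviation of Q from the diagonal, and K for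
constants. The policy enters the drift estimates only through the inner product of Q with the
dispatching probabilities, which is why equivalence in inner product suffices. The gaps Δ sum to
zero and change sign once along the sorted queues, so tilting gives ∑ q_i p_i ≤ ∑ q_i μ_i / μ_Σ: it
is at least as good as random routing with weights μ (`HoldsUpToEquiv.sum_le`). Hence ‖Q‖² has drift
at most -2ε ∑ q_i μ_i / μ_Σ + K, which gives bounded second moments and stability
(`exists_sqQueue_bound`).

A δ-tilted slot gains in addition a multiple of ‖Q_⊥‖ (`HoldsUpToEquiv.sum_le_of_delta`). The drift
of ‖Q_⊥‖² is thus at most a multiple of ε times ‖Q_⊥‖, plus K, in every slot, and at most a fixed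
negative multiple of ‖Q_⊥‖, plus K, once per window. For small ε the gain wins over the window, and
an exponential Lyapunov function bounds E‖Q_⊥‖² eventually, uniformly in ε and in the initial state
(`exists_second_moment_bound`, `exists_devQueue_bound`): state space collapse.

With net input y and unused service u, X' = X + y + u. Expanding X'² gives the drift equation of the
pooled queue, with the cross term 2X'u as the only quantity that sees the policy. Unused service
forces an empty queue at the end of the slot, so that X' ≤ N‖Q'_⊥‖ (`unused_service_bounds`). Since
u has long-run mean ε, a weighted AM-GM inequality bounds the contribution of the cross term by a
multiple of √ε (`total_sq_change_bounds`). Thus 2ε times the mean of X is E[y²] + O(√ε). The pooled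
queue satisfies the same estimate with zero in place of Q_⊥, and E[y²] is common to both systems.

The chain is inhomogeneous in time, so stationary drift equations are replaced by telescoping sums
and Cesàro averages (`cesaro_mean_bounds`). The initial law need not have moments: the process is a
mixture over deterministic initial states, from which every law has finite support, and the
asymptotic bounds do not depend on that state. -/

/-! ### Expectations under laws with finite support -/

/-- Expectation of `f` under the law `p` (used for laws with finite support). -/
noncomputable def pexp {α : Type*} (p : PMF α) (f : α → ℝ) : ℝ := ∑' x, (p x).toReal * f x

section pexp
variable {α β : Type*} {p : PMF α}

lemma pexp_eq_sum_of_subset {S : Finset α} (hS : p.support ⊆ S) (f : α → ℝ) :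
    pexp p f = ∑ x ∈ S, (p x).toReal * f x := by
  refine tsum_eq_sum fun x hx => ?_
  have : p x = 0 := by
    by_contra h
    exact hx (hS ((PMF.mem_support_iff _ _).2 h))
  simp [this]

lemma pexp_eq_sum (hp : p.support.Finite) (f : α → ℝ) :
    pexp p f = ∑ x ∈ hp.toFinset, (p x).toReal * f x :=
  pexp_eq_sum_of_subset (by simp) f

lemma PMF.hasSum_toReal (p : PMF α) : HasSum (fun x => (p x).toReal) 1 := by
  have := ENNReal.hasSum_toReal (f := p) (by simp [p.tsum_coe])
  simpa [p.tsum_coe, ← ENNReal.tsum_toReal_eq (fun x => p.apply_ne_top x)] using this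

lemma PMF.toReal_apply_le_one (p : PMF α) (x : α) : (p x).toReal ≤ 1 := by
  simpa using ENNReal.toReal_mono ENNReal.one_ne_top (p.coe_le_one x)

lemma pexp_const (c : ℝ) : pexp p (fun _ => c) = c := by
  simp [pexp, tsum_mul_right, p.hasSum_toReal.tsum_eq]

lemma pexp_add (hp : p.support.Finite) (f g : α → ℝ) :
    pexp p (fun x => f x + g x) = pexp p f + pexp p g := by
  simp [pexp_eq_sum hp, mul_add, Finset.sum_add_distrib]

lemma pexp_sub (hp : p.support.Finite) (f g : α → ℝ) :
    pexp p (fun x => f x - g x) = pexp p f - pexp p g := by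
  simp [pexp_eq_sum hp, mul_sub, Finset.sum_sub_distrib]

lemma pexp_const_mul (c : ℝ) (f : α → ℝ) :
    pexp p (fun x => c * f x) = c * pexp p f := by
  simp [pexp, mul_left_comm _ c, tsum_mul_left]

lemma pexp_sum (hp : p.support.Finite) {ι : Type*} (s : Finset ι) (f : ι → α → ℝ) :
    pexp p (fun x => ∑ i ∈ s, f i x) = ∑ i ∈ s, pexp p (f i) := by
  simp only [pexp_eq_sum hp, Finset.mul_sum]
  exact Finset.sum_comm

lemma pexp_mono (hp : p.support.Finite) {f g : α → ℝ} (h : ∀ x ∈ p.support, f x ≤ g x) :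
    pexp p f ≤ pexp p g := by
  rw [pexp_eq_sum hp, pexp_eq_sum hp]
  exact Finset.sum_le_sum fun x hx =>
    mul_le_mul_of_nonneg_left (h x (by simpa using hx)) ENNReal.toReal_nonneg

lemma pexp_congr {f g : α → ℝ} (h : ∀ x ∈ p.support, f x = g x) : pexp p f = pexp p g := by
  refine tsum_congr fun x => ?_
  by_cases hx : x ∈ p.support
  · rw [h x hx]
  · simp [(PMF.apply_eq_zero_iff _ _).2 hx]

lemma pexp_nonneg {f : α → ℝ} (h : ∀ x, 0 ≤ f x) : 0 ≤ pexp p f :=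
  tsum_nonneg fun x => mul_nonneg ENNReal.toReal_nonneg (h x)

lemma pexp_pure (a : α) (f : α → ℝ) : pexp (PMF.pure a) f = f a := by
  rw [pexp_eq_sum_of_subset (S := {a}) (by simp)]
  simp

lemma PMF.finite_support_bind (hp : p.support.Finite) {g : α → PMF β}
    (hg : ∀ x ∈ p.support, (g x).support.Finite) : (p.bind g).support.Finite := by
  rw [PMF.support_bind]
  exact hp.biUnion hg

lemma PMF.finite_support_map (hp : p.support.Finite) (h : α → β) : (p.map h).support.Finite := by
  rw [PMF.support_map]
  exact hp.image h

lemma pexp_bind (hp : p.support.Finite) {g : α → PMF β}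
    (hg : ∀ x ∈ p.support, (g x).support.Finite) (f : β → ℝ) :
    pexp (p.bind g) f = pexp p fun x => pexp (g x) f := by
  have hb := PMF.finite_support_bind hp hg
  have hval : ∀ y, ((p.bind g) y).toReal
      = ∑ x ∈ hp.toFinset, (p x).toReal * (g x y).toReal := by
    intro y
    rw [PMF.bind_apply, tsum_eq_sum (s := hp.toFinset), ENNReal.toReal_sum]
    · simp
    · intro x _
      exact ENNReal.mul_ne_top (p.apply_ne_top x) ((g x).apply_ne_top y)
    · intro x hx
      have : p x = 0 := by simpa using hx
      simp [this]
  rw [pexp_eq_sum hb, pexp_eq_sum hp]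
  simp only [hval, Finset.sum_mul]
  rw [Finset.sum_comm]
  refine Finset.sum_congr rfl fun x hx => ?_
  have hx' : x ∈ p.support := by simpa using hx
  rw [pexp_eq_sum_of_subset (S := hb.toFinset), Finset.mul_sum]
  · exact Finset.sum_congr rfl fun y _ => by ring
  · intro y hy
    simp only [Set.Finite.coe_toFinset, PMF.mem_support_bind_iff]
    exact ⟨x, hx', hy⟩

lemma pexp_map (hp : p.support.Finite) (h : α → β) (f : β → ℝ) :
    pexp (p.map h) f = pexp p fun x => f (h x) := by
  rw [← PMF.bind_pure_comp, pexp_bind hp (by simp)]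
  simp [pexp_pure]

lemma integrable_of_finite_support [MeasurableSpace α] [MeasurableSingletonClass α]
    (hp : p.support.Finite) (f : α → ℝ) : Integrable f p.toMeasure := by
  rw [← PMF.restrict_toMeasure_support p]
  exact IntegrableOn.finset (s := hp.toFinset) (f := f) (μ := p.toMeasure) |>.mono_set (by simp)

lemma integral_eq_pexp [MeasurableSpace α] [MeasurableSingletonClass α]
    (hp : p.support.Finite) (f : α → ℝ) : ∫ x, f x ∂p.toMeasure = pexp p f := by
  rw [PMF.integral_eq_tsum _ _ (integrable_of_finite_support hp f)]
  simp [pexp]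

end pexp

/-! ### An exponential drift inequality and recursions over windows -/

/-- Since Y² - y² ≥ 2y(Y - y), the quadratic drift gives E(Y - y) ≤ d/2 + K/(2y), which is at most
d/2 + κ once y ≥ K/(2κ); then e^x ≤ 1 + x + x² for |x| ≤ 1 turns this into a multiplicative bound.
Below the threshold Y is at most K/(2κ) + M, which accounts for the additive term. -/
lemma pexp_exp_le {α : Type*} {p : PMF α} (hp : p.support.Finite) (Y : α → ℝ) {y M d K κ θ : ℝ}
    (hy : 0 ≤ y) (hκ : 0 < κ) (hK : 0 ≤ K) (hθ : 0 < θ) (hθM : θ * M ≤ 1)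
    (hY : ∀ x ∈ p.support, |Y x - y| ≤ M)
    (hd : pexp p (fun x => Y x ^ 2) - y ^ 2 ≤ d * y + K) :
    pexp p (fun x => Real.exp (θ * Y x)) ≤
      Real.exp (θ * (d / 2 + κ + θ * M ^ 2)) * Real.exp (θ * y) +
        Real.exp (θ * (K / (2 * κ) + M)) := by
  rcases lt_or_ge y (K / (2 * κ)) with hlt | hge
  · have h1 : pexp p (fun x => Real.exp (θ * Y x)) ≤
        pexp p (fun _ => Real.exp (θ * (K / (2 * κ) + M))) := by
      refine pexp_mono hp fun x hx => Real.exp_le_exp.2 ?_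
      have := (abs_le.1 (hY x hx)).2
      exact mul_le_mul_of_nonneg_left (by linarith) hθ.le
    rw [pexp_const] at h1
    have := (Real.exp_pos (θ * (d / 2 + κ + θ * M ^ 2)))
    have := (Real.exp_pos (θ * y))
    nlinarith
  have hdrift : y * pexp p (fun x => Y x - y) ≤ y * (d / 2 + κ) := by
    have h2 : pexp p (fun x => 2 * y * (Y x - y)) ≤ pexp p (fun x => Y x ^ 2 - y ^ 2) :=
      pexp_mono hp fun x _ => by nlinarith [sq_nonneg (Y x - y)]
    have e1 : pexp p (fun x => Y x ^ 2 - y ^ 2) = pexp p (fun x => Y x ^ 2) - y ^ 2 := by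
      rw [pexp_sub hp, pexp_const]
    rw [pexp_const_mul, e1] at h2
    have h3 : K ≤ y * (2 * κ) := (div_le_iff₀ (by positivity)).1 hge
    nlinarith
  have hexp : ∀ x ∈ p.support, Real.exp (θ * Y x) ≤
      Real.exp (θ * y) * (1 + θ * (Y x - y) + θ ^ 2 * M ^ 2) := by
    intro x hx
    have hx' := hY x hx
    have habs : |θ * (Y x - y)| ≤ θ * M := by
      rw [abs_mul, abs_of_pos hθ]; exact mul_le_mul_of_nonneg_left hx' hθ.le
    have h4 := (abs_le.1 (Real.abs_exp_sub_one_sub_id_le (habs.trans hθM))).2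
    have h5 : (θ * (Y x - y)) ^ 2 ≤ θ ^ 2 * M ^ 2 := by
      rw [← sq_abs, ← mul_pow]; exact pow_le_pow_left₀ (abs_nonneg _) habs 2
    have h6 : θ * Y x = θ * y + θ * (Y x - y) := by ring
    rw [h6, Real.exp_add]
    exact mul_le_mul_of_nonneg_left (by linarith) (Real.exp_pos _).le
  have h7 := pexp_mono hp hexp
  rw [pexp_const_mul, pexp_add hp, pexp_add hp, pexp_const, pexp_const, pexp_const_mul] at h7
  -- The threshold is zero when K = 0, so y = 0 is still possible here and the drift cannot be
  -- divided by y.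
  rcases hy.eq_or_lt with h0 | hpos
  · subst h0
    have hb : pexp p (fun x => Real.exp (θ * Y x)) ≤
        pexp p (fun _ => Real.exp (θ * (K / (2 * κ) + M))) := by
      refine pexp_mono hp fun x hx => Real.exp_le_exp.2 ?_
      have := (abs_le.1 (hY x hx)).2
      have : 0 ≤ K / (2 * κ) := by positivity
      exact mul_le_mul_of_nonneg_left (by linarith) hθ.le
    rw [pexp_const] at hb
    have := (Real.exp_pos (θ * (d / 2 + κ + θ * M ^ 2)))
    have := (Real.exp_pos (θ * 0))
    nlinarith
  have h8 : pexp p (fun x => Y x - y) ≤ d / 2 + κ := le_of_mul_le_mul_left hdrift hpos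
  have h9 : 1 + θ * pexp p (fun x => Y x - y) + θ ^ 2 * M ^ 2 ≤
      Real.exp (θ * (d / 2 + κ + θ * M ^ 2)) := by
    have := Real.add_one_le_exp (θ * (d / 2 + κ + θ * M ^ 2))
    nlinarith
  have h10 := mul_le_mul_of_nonneg_left h9 (Real.exp_pos (θ * y)).le
  have := Real.exp_pos (θ * (K / (2 * κ) + M))
  linarith

lemma recursion_le {f : ℕ → ℝ} {r C : ℝ} (hr : 1 ≤ r) (hC : 0 ≤ C)
    (h : ∀ t, f (t + 1) ≤ r * f t + C) (s n : ℕ) : f (s + n) ≤ r ^ n * (f s + n * C) := by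
  induction n with
  | zero => simp
  | succ n ih =>
    have h1 : 1 ≤ r ^ (n + 1) := one_le_pow₀ hr
    calc f (s + (n + 1)) ≤ r * f (s + n) + C := h (s + n)
      _ ≤ r * (r ^ n * (f s + n * C)) + r ^ (n + 1) * C := by
        have := mul_le_mul_of_nonneg_left ih (zero_le_one.trans hr)
        nlinarith
      _ = r ^ (n + 1) * (f s + (n + 1 : ℕ) * C) := by push_cast; ring

lemma eventually_le_of_contraction {g : ℕ → ℝ} {ρ C : ℝ} (hρ0 : 0 ≤ ρ) (hρ1 : ρ < 1)
    (h : ∀ k, g (k + 1) ≤ ρ * g k + C) : ∀ᶠ k in atTop, g k ≤ C / (1 - ρ) + 1 := by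
  have hb : ∀ k, g k - C / (1 - ρ) ≤ ρ ^ k * (g 0 - C / (1 - ρ)) := by
    intro k
    induction k with
    | zero => simp
    | succ k ih =>
      have h1 : C = C / (1 - ρ) - ρ * (C / (1 - ρ)) := by
        have : (1 - ρ) ≠ 0 := by linarith
        field_simp
      have h2 := mul_le_mul_of_nonneg_left ih hρ0
      have h3 := h k
      rw [pow_succ]
      nlinarith
  have ht : Tendsto (fun k => ρ ^ k * (g 0 - C / (1 - ρ))) atTop (𝓝 (0 * (g 0 - C / (1 - ρ)))) :=
    (tendsto_pow_atTop_nhds_zero_of_lt_one hρ0 hρ1).mul_const _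
  rw [zero_mul] at ht
  filter_upwards [ht.eventually (gt_mem_nhds one_pos)] with k hk
  have := hb k
  linarith

/-- If `f` grows at most by a factor `exp a` in each slot, and is contracted by `exp (-b)` in one
slot of every window of length `T`, where `T * a < b`, then `f` is eventually below a bound that
does not depend on its initial value. -/
lemma eventually_le_of_windows (T : ℕ) (hT : 0 < T) {a b C : ℝ} (ha : 0 ≤ a) (hab : T * a < b)
    (hC : 0 ≤ C) : ∃ C' : ℝ, 0 ≤ C' ∧ ∀ f : ℕ → ℝ, (∀ t, 0 ≤ f t) →
      (∀ t, f (t + 1) ≤ Real.exp a * f t + C) →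
      (∀ k, ∃ t, k * T ≤ t ∧ t < (k + 1) * T ∧ f (t + 1) ≤ Real.exp (-b) * f t + C) →
      ∀ᶠ t in atTop, f t ≤ C' := by
  set r := Real.exp a with hr
  have hr1 : 1 ≤ r := Real.one_le_exp ha
  have hb : 0 ≤ b := le_trans (by positivity) hab.le
  -- Net factor over one window; it allows for T growth slots although only T - 1 remain besides the
  -- contracting one.
  set ρ := Real.exp (T * a - b) with hρ
  have hρ1 : ρ < 1 := by rw [hρ]; exact (Real.exp_lt_exp.2 (by linarith)).trans_eq Real.exp_zero
  have hρ0 : 0 ≤ ρ := (Real.exp_pos _).le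
  have hrT : 1 ≤ r ^ T := one_le_pow₀ hr1
  -- The additive constant enters at most T times before the contracting slot, once in it, and at
  -- most T times after it.
  set C₁ := r ^ T * ((2 * T + 1) * C) with hC₁
  refine ⟨r ^ T * ((C₁ / (1 - ρ) + 1) + T * C), ?_, fun f hf hstep hwin => ?_⟩
  · have : 0 < 1 - ρ := by linarith
    positivity
  have hcontr : ∀ k, f ((k + 1) * T) ≤ ρ * f (k * T) + C₁ := by
    intro k
    obtain ⟨t, ht1, ht2, ht3⟩ := hwin k
    obtain ⟨j, rfl⟩ := Nat.exists_eq_add_of_le ht1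
    obtain ⟨i, hi⟩ := Nat.exists_eq_add_of_lt ht2
    have hT' : T = j + 1 + i := by
      have : (k + 1) * T = k * T + T := by ring
      omega
    have e1 : (k + 1) * T = k * T + j + 1 + i := by omega
    have h1 := recursion_le hr1 hC hstep (k * T + j + 1) i
    have h2 := recursion_le hr1 hC hstep (k * T) j
    have hx := hf (k * T)
    have hE : 0 ≤ Real.exp (-b) := (Real.exp_pos _).le
    have hE1 : Real.exp (-b) ≤ 1 := Real.exp_le_one_iff.2 (by linarith)
    have hjr : r ^ j ≤ r ^ T := pow_le_pow_right₀ hr1 (by omega)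
    have hir : r ^ i ≤ r ^ T := pow_le_pow_right₀ hr1 (by omega)
    have hijr : r ^ i * r ^ j ≤ r ^ T := by
      rw [← pow_add]; exact pow_le_pow_right₀ hr1 (by omega)
    have hrho : ρ = Real.exp (-b) * r ^ T := by
      rw [hρ, hr, ← Real.exp_nat_mul, ← Real.exp_add]; ring_nf
    have hj : (j : ℝ) ≤ T := by exact_mod_cast (by omega : j ≤ T)
    have hi' : (i : ℝ) ≤ T := by exact_mod_cast (by omega : i ≤ T)
    have hri : 0 ≤ r ^ i := by positivity
    have hrj : 0 ≤ r ^ j := by positivity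
    calc f ((k + 1) * T) = f (k * T + j + 1 + i) := by rw [e1]
      _ ≤ r ^ i * (f (k * T + j + 1) + i * C) := h1
      _ ≤ r ^ i * (Real.exp (-b) * (r ^ j * (f (k * T) + j * C)) + C + i * C) := by
          refine mul_le_mul_of_nonneg_left ?_ hri
          have := mul_le_mul_of_nonneg_left h2 hE
          linarith
      _ = Real.exp (-b) * (r ^ i * r ^ j) * f (k * T) +
            (Real.exp (-b) * (r ^ i * r ^ j) * (j * C) + r ^ i * (C + i * C)) := by ring
      _ ≤ Real.exp (-b) * r ^ T * f (k * T) + (1 * r ^ T * (T * C) + r ^ T * (C + T * C)) := by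
          gcongr
      _ = ρ * f (k * T) + C₁ := by rw [hrho, hC₁]; ring
  have hev := eventually_le_of_contraction (g := fun k => f (k * T)) hρ0 hρ1 hcontr
  have hdiv : Tendsto (fun t : ℕ => t / T) atTop atTop := Nat.tendsto_div_const_atTop hT.ne'
  filter_upwards [hdiv.eventually hev] with t ht
  have h1 := recursion_le hr1 hC hstep (t / T * T) (t % T)
  rw [Nat.div_add_mod' t T] at h1
  have hmod : t % T ≤ T := (Nat.mod_lt t hT).le
  have hmod' : ((t % T : ℕ) : ℝ) ≤ T := by exact_mod_cast hmod
  have hpow : r ^ (t % T) ≤ r ^ T := pow_le_pow_right₀ hr1 hmod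
  have hpos : 0 ≤ f (t / T * T) := hf _
  calc f t ≤ r ^ (t % T) * (f (t / T * T) + (t % T : ℕ) * C) := h1
    _ ≤ r ^ T * ((C₁ / (1 - ρ) + 1) + T * C) := by
      gcongr

lemma exists_bound_of_eventually_le {f : ℕ → ℝ} {C : ℝ} (h : ∀ᶠ t in atTop, f t ≤ C) :
    ∃ r, 0 ≤ r ∧ ∀ t, f t ≤ r := by
  obtain ⟨n, hn⟩ := eventually_atTop.1 h
  have hbdd : BddAbove (Set.range f) := by
    refine ((Set.finite_Iio n).image f).bddAbove.union (bddAbove_Iic (a := C)) |>.mono ?_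
    rintro _ ⟨t, rfl⟩
    rcases lt_or_ge t n with ht | ht
    · exact Or.inl ⟨t, ht, rfl⟩
    · exact Or.inr (hn t ht)
  obtain ⟨r, hr⟩ := hbdd
  exact ⟨max r 0, le_max_right _ _, fun t => (hr ⟨t, rfl⟩).trans (le_max_left _ _)⟩

/-! ### Cesàro averages and the telescoped drift of the total queue length. -/

/-- The Cesàro average of the first `n` terms. -/
noncomputable def cesaro (f : ℕ → ℝ) (n : ℕ) : ℝ := (∑ t ∈ Finset.range n, f t) / n

lemma cesaro_eventually_le {f : ℕ → ℝ} {C : ℝ} (hC : ∀ᶠ t in atTop, f t ≤ C) {η : ℝ}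
    (hη : 0 < η) : ∀ᶠ n in atTop, cesaro f n ≤ C + η := by
  obtain ⟨n₀, hn₀⟩ := eventually_atTop.1 hC
  obtain ⟨r, hr0, hr⟩ := exists_bound_of_eventually_le hC
  have hlim : Tendsto (fun n : ℕ => (n₀ * (r + |C|)) / (n : ℝ)) atTop (𝓝 0) :=
    tendsto_const_div_atTop_nhds_zero_nat _
  filter_upwards [hlim.eventually (gt_mem_nhds hη), eventually_ge_atTop n₀, eventually_gt_atTop 0]
    with n hn hnn hpos
  have hpos' : (0 : ℝ) < n := by exact_mod_cast hpos
  have hsum : ∑ t ∈ Finset.range n, f t ≤ n₀ * (r + |C|) + n * C := by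
    have : ∀ t ∈ Finset.range n, f t ≤ (if t < n₀ then r + |C| else 0) + C := by
      intro t _
      split_ifs with h
      · have := neg_abs_le C; linarith [hr t]
      · linarith [hn₀ t (not_lt.1 h)]
    refine (Finset.sum_le_sum this).trans ?_
    rw [Finset.sum_add_distrib, ← Finset.sum_filter]
    have : (Finset.range n).filter (fun t => t < n₀) = Finset.range n₀ := by
      ext t; simp; omega
    rw [this]
    simp [mul_add]
  rw [cesaro, div_le_iff₀ hpos']
  rw [div_lt_iff₀ hpos'] at hn
  nlinarith

/-- Telescoped form of the drift of the square of the total queue length: `b`, `m` and `v` are the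
second moment, the mean and the deviation from the diagonal. -/
lemma cesaro_mean_bounds {b m v : ℕ → ℝ} {ε G M c r Cv : ℝ} (hε : 0 < ε) (hM : 0 ≤ M) (hc : 0 ≤ c)
    (hb0 : ∀ t, 0 ≤ b t) (hm0 : ∀ t, 0 ≤ m t) (hb : ∀ t, b t ≤ r) (hm : ∀ t, m t ≤ r)
    (hv : ∀ᶠ t in atTop, v t ≤ Cv)
    (hlow : ∀ t, -(M * (m (t + 1) - m t + ε)) ≤ b (t + 1) - b t + 2 * ε * m t - G)
    (hupp : ∀ t, b (t + 1) - b t + 2 * ε * m t - G ≤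
      √ε * c * v (t + 1) + M / √ε * (m (t + 1) - m t + ε)) :
    ∀ η > 0, ∀ᶠ n in atTop, (G - M * ε) / (2 * ε) - η ≤ cesaro m n ∧
      cesaro m n ≤ (G + √ε * (c * Cv + M)) / (2 * ε) + η := by
  intro η hη
  have hs : 0 < √ε := Real.sqrt_pos.2 hε
  have hss : √ε * √ε = ε := Real.mul_self_sqrt hε.le
  have hv' : ∀ᶠ t in atTop, v (t + 1) ≤ Cv := (tendsto_add_atTop_nat 1).eventually hv
  -- Tolerance for the average of `v`, chosen so that after multiplication by √ε * c it costs at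
  -- most η * ε.
  have hη' : 0 < η * ε / (√ε * c + 1) := by positivity
  have hces := cesaro_eventually_le hv' hη'
  have hr : 0 ≤ r := (hb0 0).trans (hb 0)
  -- Dominates all boundary terms left by telescoping; they vanish after division by n.
  have hlim : Tendsto (fun n : ℕ => (r + M / √ε * r + M * r) / (n : ℝ)) atTop (𝓝 0) :=
    tendsto_const_div_atTop_nhds_zero_nat _
  filter_upwards [hces, hlim.eventually (gt_mem_nhds (mul_pos hη hε)), eventually_gt_atTop 0]
    with n hn1 hn2 hn
  have hn' : (0 : ℝ) < n := by exact_mod_cast hn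
  have htb : ∑ t ∈ Finset.range n, (b (t + 1) - b t) = b n - b 0 := Finset.sum_range_sub b n
  have htm : ∑ t ∈ Finset.range n, (m (t + 1) - m t) = m n - m 0 := Finset.sum_range_sub m n
  have hmid : ∑ t ∈ Finset.range n, (b (t + 1) - b t + 2 * ε * m t - G) =
      b n - b 0 + 2 * ε * ∑ t ∈ Finset.range n, m t - n * G := by
    rw [Finset.sum_sub_distrib, Finset.sum_add_distrib, htb, Finset.mul_sum]
    simp
  have hmm : ∑ t ∈ Finset.range n, (m (t + 1) - m t + ε) = m n - m 0 + n * ε := by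
    rw [Finset.sum_add_distrib, htm]; simp
  have hL := Finset.sum_le_sum fun t (_ : t ∈ Finset.range n) => hlow t
  have hU := Finset.sum_le_sum fun t (_ : t ∈ Finset.range n) => hupp t
  rw [hmid] at hL hU
  rw [Finset.sum_neg_distrib, ← Finset.mul_sum, hmm] at hL
  rw [Finset.sum_add_distrib, ← Finset.mul_sum, ← Finset.mul_sum, hmm] at hU
  have hcm : ∑ t ∈ Finset.range n, m t = cesaro m n * n := by
    rw [cesaro]; field_simp
  have hcv : ∑ t ∈ Finset.range n, v (t + 1) = cesaro (fun t => v (t + 1)) n * n := by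
    rw [cesaro]; field_simp
  rw [hcm] at hL hU
  rw [hcv] at hU
  rw [div_lt_iff₀ hn'] at hn2
  have hMs : 0 ≤ M / √ε := by positivity
  have hMr : 0 ≤ M * r := by positivity
  have hMsr : 0 ≤ M / √ε * r := by positivity
  -- The long-run average ε of the unused service compensates the weight 1/√ε.
  have hmul : M / √ε * ε = √ε * M := by
    field_simp; nlinarith
  have h2ε : (0 : ℝ) < 2 * ε := by linarith
  constructor
  · have h1 : M * (m n - m 0) ≤ M * r := mul_le_mul_of_nonneg_left (by linarith [hm n, hm0 0]) hM
    have h2 : (n : ℝ) * (G - M * ε - 2 * ε * η) ≤ n * (2 * ε * cesaro m n) := by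
      have := hb n
      have := hb0 0
      have : 0 < η * ε * n := by positivity
      linarith
    have h3 := le_of_mul_le_mul_left h2 hn'
    rw [sub_le_iff_le_add, div_le_iff₀ h2ε]
    linarith
  · have h1 : M / √ε * (m n - m 0) ≤ M / √ε * r :=
      mul_le_mul_of_nonneg_left (by linarith [hm n, hm0 0]) hMs
    have h4 : √ε * c * cesaro (fun t => v (t + 1)) n ≤ √ε * c * Cv + η * ε := by
      have h5 : √ε * c * cesaro (fun t => v (t + 1)) n ≤
          √ε * c * (Cv + η * ε / (√ε * c + 1)) := mul_le_mul_of_nonneg_left hn1 (by positivity)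
      have h6 : √ε * c * (η * ε / (√ε * c + 1)) ≤ η * ε := by
        rw [mul_div_assoc', div_le_iff₀ (by positivity)]
        have : 0 < η * ε := by positivity
        nlinarith
      nlinarith
    have h7 := mul_le_mul_of_nonneg_right h4 hn'.le
    have h2 : (n : ℝ) * (2 * ε * cesaro m n) ≤
        n * (G + √ε * (c * Cv + M) + 2 * ε * η) := by
      have := hb 0
      have := hb0 n
      have e : M / √ε * (m n - m 0 + n * ε) = M / √ε * (m n - m 0) + √ε * M * n := by
        rw [mul_add, ← hmul]; ring
      rw [e] at hU
      linarith
    have h3 := le_of_mul_le_mul_left h2 hn'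
    rw [← sub_le_iff_le_add, le_div_iff₀ h2ε]
    linarith

/-! ### Mixtures of processes and their steady states -/

lemma cesaro_mono {f g : ℕ → ℝ} (h : ∀ t, f t ≤ g t) (n : ℕ) : cesaro f n ≤ cesaro g n :=
  div_le_div_of_nonneg_right (Finset.sum_le_sum fun t _ => h t) (Nat.cast_nonneg n)

lemma cesaro_sum {ι : Type*} (s : Finset ι) (w : ι → ℝ) (f : ι → ℕ → ℝ) (n : ℕ) :
    cesaro (fun t => ∑ i ∈ s, w i * f i t) n = ∑ i ∈ s, w i * cesaro (f i) n := by
  simp only [cesaro]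
  rw [Finset.sum_comm, Finset.sum_div]
  exact Finset.sum_congr rfl fun i _ => by rw [← Finset.mul_sum, mul_div_assoc]

lemma cesaro_add_const (f : ℕ → ℝ) (c : ℝ) {n : ℕ} (hn : 0 < n) :
    cesaro (fun t => f t + c) n = cesaro f n + c := by
  have : (n : ℝ) ≠ 0 := by positivity
  simp [cesaro, Finset.sum_add_distrib, add_div, this]

section mixture
variable {ζ α : Type*} {init : PMF ζ} {L : ζ → ℕ → PMF α} {f : α → ℝ}

lemma PMF.exists_finset_mass (init : PMF ζ) {η : ℝ} (hη : 0 < η) :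
    ∃ F : Finset ζ, (∀ z ∈ F, z ∈ init.support) ∧ 1 - η ≤ ∑ z ∈ F, (init z).toReal := by
  classical
  have h := init.hasSum_toReal.eventually (lt_mem_nhds (by linarith : 1 - η < 1))
  obtain ⟨F, hF⟩ := h.exists
  refine ⟨F.filter (fun z => z ∈ init.support), by simp, hF.le.trans_eq ?_⟩
  rw [Finset.sum_filter]
  refine Finset.sum_congr rfl fun z _ => ?_
  split_ifs with hz
  · rfl
  · simp [(PMF.apply_eq_zero_iff _ _).2 hz]

lemma PMF.sum_toReal_le_one (init : PMF ζ) (F : Finset ζ) : ∑ z ∈ F, (init z).toReal ≤ 1 :=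
  sum_le_hasSum F (fun _ _ => ENNReal.toReal_nonneg) init.hasSum_toReal

lemma PMF.hasSum_bind_toReal (init : PMF ζ) (L : ζ → PMF α) (x : α) :
    HasSum (fun z => (init z).toReal * (L z x).toReal) ((init.bind L) x).toReal := by
  have hs : Summable fun z => (init z).toReal * (L z x).toReal :=
    init.hasSum_toReal.summable.of_nonneg_of_le (fun z => by positivity) fun z =>
      mul_le_of_le_one_right ENNReal.toReal_nonneg ((L z).toReal_apply_le_one x)
  convert hs.hasSum using 1
  rw [PMF.bind_apply, ENNReal.tsum_toReal_eq]
  · simp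
  · exact fun z => ENNReal.mul_ne_top (init.apply_ne_top z) ((L z).apply_ne_top x)

lemma PMF.le_bind_toReal (init : PMF ζ) (L : ζ → PMF α) (F : Finset ζ) (x : α) :
    ∑ z ∈ F, (init z).toReal * (L z x).toReal ≤ ((init.bind L) x).toReal :=
  sum_le_hasSum F (fun _ _ => by positivity) (init.hasSum_bind_toReal L x)

/-- Components outside `F` give a point mass at most one each, so truncating the mixture costs no
more than the missing weight. -/
lemma PMF.bind_toReal_le (init : PMF ζ) (L : ζ → PMF α) (F : Finset ζ) (x : α) :
    ((init.bind L) x).toReal ≤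
      ∑ z ∈ F, (init z).toReal * (L z x).toReal + (1 - ∑ z ∈ F, (init z).toReal) := by
  have h := init.hasSum_toReal.sub (init.hasSum_bind_toReal L x)
  have := sum_le_hasSum F (fun z _ => sub_nonneg.2 (mul_le_of_le_one_right ENNReal.toReal_nonneg
    ((L z).toReal_apply_le_one x))) h
  rw [Finset.sum_sub_distrib] at this
  linarith

/-- Markov's inequality with weight `h`: where f > K, h ≤ f h / K. The choice h = 1 yields
tightness, and h = f yields uniform integrability from second moments. -/
lemma pexp_sub_div_le {p : PMF α} (hp : p.support.Finite) {h : α → ℝ} (hf : ∀ x, 0 ≤ f x)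
    (hh : ∀ x, 0 ≤ h x) {K r : ℝ} (hK : 0 < K) (hfin : {x | f x ≤ K}.Finite)
    (hr : pexp p (fun x => f x * h x) ≤ r) :
    pexp p h - r / K ≤ ∑ x ∈ hfin.toFinset, h x * (p x).toReal := by
  classical
  have h1 : pexp p h ≤ pexp p fun x => (if f x ≤ K then h x else 0) + K⁻¹ * (f x * h x) := by
    refine pexp_mono hp fun x _ => ?_
    have := hf x
    have := hh x
    split_ifs with hx
    · have : 0 ≤ K⁻¹ * (f x * h x) := by positivity
      linarith
    · rw [zero_add, inv_mul_eq_div, le_div_iff₀ hK]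
      nlinarith
  rw [pexp_add hp, pexp_const_mul] at h1
  have h2 : pexp p (fun x => if f x ≤ K then h x else 0) ≤
      ∑ x ∈ hfin.toFinset, h x * (p x).toReal := by
    rw [pexp_eq_sum hp]
    simp only [mul_ite, mul_zero]
    rw [← Finset.sum_filter]
    refine (Finset.sum_le_sum_of_subset_of_nonneg (t := hfin.toFinset) ?_ ?_).trans_eq ?_
    · intro x hx
      simpa using (Finset.mem_filter.1 hx).2
    · exact fun x _ _ => mul_nonneg ENNReal.toReal_nonneg (hh x)
    · exact Finset.sum_congr rfl fun x _ => mul_comm _ _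
  have h3 : K⁻¹ * pexp p (fun x => f x * h x) ≤ r / K := by
    rw [inv_mul_eq_div]; gcongr
  linarith

/-- Tightness of a mixture of processes with bounded means. -/
lemma exists_mass_sublevel (hf : ∀ x, 0 ≤ f x) (hfin : ∀ K : ℝ, {x | f x ≤ K}.Finite)
    (hL : ∀ z ∈ init.support, ∀ t, (L z t).support.Finite)
    (hr : ∀ z ∈ init.support, ∃ r, ∀ t, pexp (L z t) f ≤ r) {η : ℝ} (hη : 0 < η) :
    ∃ K : ℝ, ∀ t, 1 - η ≤ ∑ x ∈ (hfin K).toFinset, ((init.bind (L · t)) x).toReal := by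
  obtain ⟨F, hF, hmass⟩ := init.exists_finset_mass (half_pos hη)
  choose! r hr using hr
  -- The bounds depend on the initial state; one level K serves all of them because `F` is finite.
  have hev : ∀ᶠ K : ℝ in atTop, ∀ z ∈ F, r z / K ≤ η / 2 := by
    rw [Filter.eventually_all_finset]
    intro z _
    exact ((tendsto_const_nhds (x := r z)).div_atTop tendsto_id).eventually
      (ge_mem_nhds (half_pos hη))
  obtain ⟨K, hK, hK0⟩ := (hev.and (eventually_gt_atTop 0)).exists
  refine ⟨K, fun t => ?_⟩
  have h1 : ∀ z ∈ F, 1 - η / 2 ≤ ∑ x ∈ (hfin K).toFinset, (L z t x).toReal := by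
    intro z hz
    have := pexp_sub_div_le (hL z (hF z hz) t) (h := fun _ => 1) hf (by simp) hK0 (hfin K)
      (r := r z) (by simpa using hr z (hF z hz) t)
    rw [pexp_const] at this
    simp only [one_mul] at this
    linarith [hK z hz]
  have h2 : ∑ z ∈ F, (init z).toReal * (1 - η / 2) ≤
      ∑ x ∈ (hfin K).toFinset, ((init.bind (L · t)) x).toReal := by
    calc _ ≤ ∑ z ∈ F, (init z).toReal * ∑ x ∈ (hfin K).toFinset, (L z t x).toReal :=
          Finset.sum_le_sum fun z hz => mul_le_mul_of_nonneg_left (h1 z hz) ENNReal.toReal_nonneg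
      _ = ∑ x ∈ (hfin K).toFinset, ∑ z ∈ F, (init z).toReal * (L z t x).toReal := by
          simp only [Finset.mul_sum]; exact Finset.sum_comm
      _ ≤ _ := Finset.sum_le_sum fun x _ => init.le_bind_toReal (L · t) F x
  rw [← Finset.sum_mul] at h2
  have := init.sum_toReal_le_one F
  nlinarith

/-- The averaged mass functions lie in the compact metrizable space [0,1]^α, so a subsequence
converges pointwise; tightness prevents loss of mass in the limit. -/
lemma exists_isSteadyState_of_tight [Countable α] {law : ℕ → PMF α}
    (htight : ∀ η : ℝ, 0 < η → ∃ S : Finset α, ∀ t, 1 - η ≤ ∑ x ∈ S, (law t x).toReal) :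
    ∃ π, IsSteadyState law π := by
  set p : ℕ → α → ℝ := fun n x => cesaro (fun t => (law t x).toReal) n with hp
  have hp01 : ∀ n, p n ∈ Set.univ.pi fun _ : α => Set.Icc (0 : ℝ) 1 := by
    intro n x _
    refine ⟨div_nonneg (Finset.sum_nonneg fun _ _ => ENNReal.toReal_nonneg) (Nat.cast_nonneg n),
      div_le_one_of_le₀ ?_ (Nat.cast_nonneg n)⟩
    calc _ ≤ ∑ t ∈ Finset.range n, (1 : ℝ) :=
          Finset.sum_le_sum fun t _ => (law t).toReal_apply_le_one x
      _ = n := by simp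
  obtain ⟨g, hg, φ, hφ, hlim⟩ :=
    (isCompact_univ_pi fun _ : α => isCompact_Icc (a := (0 : ℝ)) (b := 1)).tendsto_subseq hp01
  have hlim' : ∀ x, Tendsto (fun k => p (φ k) x) atTop (𝓝 (g x)) := fun x =>
    (tendsto_pi_nhds.1 hlim) x
  have hg0 : ∀ x, 0 ≤ g x := fun x => (hg x trivial).1
  have hsum : ∀ (S : Finset α) n,
      ∑ x ∈ S, p n x = cesaro (fun t => ∑ x ∈ S, (law t x).toReal) n := by
    intro S n
    simpa using (cesaro_sum S (fun _ => 1) (fun x t => (law t x).toReal) n).symm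
  have hlimS : ∀ S : Finset α, Tendsto (fun k => ∑ x ∈ S, p (φ k) x) atTop (𝓝 (∑ x ∈ S, g x)) :=
    fun S => tendsto_finsetSum S fun x _ => hlim' x
  have hpos : ∀ᶠ k in atTop, 0 < φ k := hφ.tendsto_atTop.eventually (eventually_gt_atTop 0)
  have hconst : ∀ (c : ℝ) {n : ℕ}, 0 < n → cesaro (fun _ => c) n = c := by
    intro c n hn
    have : (n : ℝ) ≠ 0 := by positivity
    simp [cesaro, this]
  have hle : ∀ S : Finset α, ∑ x ∈ S, g x ≤ 1 := by
    intro S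
    refine le_of_tendsto (hlimS S) ?_
    filter_upwards [hpos] with k hk
    rw [hsum]
    exact (cesaro_mono (fun t => (law t).sum_toReal_le_one S) _).trans_eq (hconst 1 hk)
  have hsummable : Summable g := summable_of_sum_le hg0 hle
  have htsum : ∑' x, g x = 1 := by
    refine le_antisymm (hsummable.tsum_le_of_sum_le hle) (le_of_forall_pos_le_add fun η hη => ?_)
    obtain ⟨S, hS⟩ := htight η hη
    have : 1 - η ≤ ∑ x ∈ S, g x := by
      refine ge_of_tendsto (hlimS S) ?_
      filter_upwards [hpos] with k hk
      rw [hsum]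
      exact (hconst (1 - η) hk).symm.le.trans (cesaro_mono hS _)
    linarith [hsummable.sum_le_tsum S fun x _ => hg0 x]
  refine ⟨⟨fun x => ENNReal.ofReal (g x), ?_⟩, φ, hφ, fun x => ?_⟩
  · rw [← ENNReal.ofReal_one, ← htsum, ENNReal.ofReal_tsum_of_nonneg hg0 hsummable]
    exact ENNReal.summable.hasSum
  · have : (ENNReal.ofReal (g x)).toReal = g x := ENNReal.toReal_ofReal (hg0 x)
    change Tendsto _ _ (𝓝 (ENNReal.ofReal (g x)).toReal)
    rw [this]
    exact hlim' x

/-- The weighted sums over finite sets converge along a sequence that defines a steady state. -/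
lemma tendsto_cesaro_sum {law : ℕ → PMF α} {π : PMF α} {φ : ℕ → ℕ}
    (h : ∀ x, Tendsto (fun k => (∑ t ∈ Finset.range (φ k), (law t x).toReal) / (φ k : ℝ)) atTop
      (𝓝 (π x).toReal)) (S : Finset α) (w : α → ℝ) :
    Tendsto (fun k => cesaro (fun t => ∑ x ∈ S, w x * (law t x).toReal) (φ k)) atTop
      (𝓝 (∑ x ∈ S, w x * (π x).toReal)) := by
  simp only [cesaro_sum]
  exact tendsto_finsetSum S fun x _ => (h x).const_mul (w x)

/-- Restriction to a finite `S` makes f bounded there, so the initial states outside a finite set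
contribute little even though their moments are not controlled uniformly in time. -/
lemma sum_le_of_isSteadyState (hf : ∀ x, 0 ≤ f x)
    (hL : ∀ z ∈ init.support, ∀ t, (L z t).support.Finite) {C : ℝ} (hC0 : 0 ≤ C)
    (hC : ∀ z ∈ init.support, ∀ η > 0, ∀ᶠ n in atTop, cesaro (fun t => pexp (L z t) f) n ≤ C + η)
    {π : PMF α} (hπ : IsSteadyState (fun t => init.bind (L · t)) π) (S : Finset α) :
    ∑ x ∈ S, f x * (π x).toReal ≤ C := by
  obtain ⟨φ, hφ, hlim⟩ := hπ
  refine le_of_forall_pos_le_add fun η hη => ?_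
  set W := ∑ x ∈ S, f x with hW
  have hW0 : 0 ≤ W := Finset.sum_nonneg fun x _ => hf x
  -- The discarded mass is multiplied by at most W, so it costs at most η / 2.
  obtain ⟨F, hF, hmass⟩ := init.exists_finset_mass (η := η / (2 * (W + 1))) (by positivity)
  have hev : ∀ᶠ n in atTop, ∀ z ∈ F, cesaro (fun t => pexp (L z t) f) n ≤ C + η / 2 := by
    rw [Filter.eventually_all_finset]
    exact fun z hz => hC z (hF z hz) _ (half_pos hη)
  refine le_of_tendsto (tendsto_cesaro_sum hlim S f) ?_
  filter_upwards [hφ.tendsto_atTop.eventually hev,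
    hφ.tendsto_atTop.eventually (eventually_gt_atTop 0)] with k hk hk0
  set n := φ k
  have hone := init.sum_toReal_le_one F
  have hbound : ∀ t, ∑ x ∈ S, f x * ((init.bind (L · t)) x).toReal ≤
      ∑ z ∈ F, (init z).toReal * pexp (L z t) f +
        W * (1 - ∑ z ∈ F, (init z).toReal) := by
    intro t
    calc _ ≤ ∑ x ∈ S, f x * (∑ z ∈ F, (init z).toReal * (L z t x).toReal +
              (1 - ∑ z ∈ F, (init z).toReal)) :=
          Finset.sum_le_sum fun x _ =>
            mul_le_mul_of_nonneg_left (init.bind_toReal_le (L · t) F x) (hf x)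
      _ = ∑ z ∈ F, (init z).toReal * ∑ x ∈ S, (L z t x).toReal * f x +
            W * (1 - ∑ z ∈ F, (init z).toReal) := by
          simp only [mul_add, Finset.sum_add_distrib, ← Finset.sum_mul, hW, Finset.mul_sum]
          rw [Finset.sum_comm]
          congr 1
          exact Finset.sum_congr rfl fun z _ => Finset.sum_congr rfl fun x _ => by ring
      _ ≤ _ := by
          gcongr with z hz
          have hs := hL z (hF z hz) t
          refine Summable.sum_le_tsum S (fun x _ => mul_nonneg ENNReal.toReal_nonneg (hf x)) ?_
          refine summable_of_ne_finset_zero (s := hs.toFinset) fun x hx => ?_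
          have : L z t x = 0 := by simpa using hx
          simp [this]
  calc _ ≤ _ := cesaro_mono hbound n
    _ = ∑ z ∈ F, (init z).toReal * cesaro (fun t => pexp (L z t) f) n +
          W * (1 - ∑ z ∈ F, (init z).toReal) := by
        rw [cesaro_add_const _ _ hk0, cesaro_sum]
    _ ≤ ∑ z ∈ F, (init z).toReal * (C + η / 2) + W * (η / (2 * (W + 1))) := by
        gcongr with z hz
        · exact hk z hz
        · linarith
    _ ≤ 1 * (C + η / 2) + η / 2 := by
        rw [← Finset.sum_mul]
        gcongr
        rw [mul_div_assoc', div_le_iff₀ (by positivity)]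
        nlinarith
    _ = C + η := by ring

/-! ### Means of steady states bounded by asymptotic Cesàro means. -/

section integral
variable [Countable α] [MeasurableSpace α] [MeasurableSingletonClass α]

lemma PMF.integrable_of_sum_le {π : PMF α} (hf : ∀ x, 0 ≤ f x) {C : ℝ}
    (h : ∀ S : Finset α, ∑ x ∈ S, f x * (π x).toReal ≤ C) : Integrable f π.toMeasure := by
  have hm : Measurable f := measurable_of_countable f
  refine ⟨hm.aestronglyMeasurable, ?_⟩
  rw [HasFiniteIntegral, lintegral_countable']
  have hs : Summable fun x => f x * (π x).toReal :=
    summable_of_sum_le (fun x => mul_nonneg (hf x) ENNReal.toReal_nonneg) h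
  have hterm : ∀ x, ‖f x‖ₑ * π.toMeasure {x} = ENNReal.ofReal (f x * (π x).toReal) := by
    intro x
    rw [PMF.toMeasure_apply_singleton _ _ (measurableSet_singleton x),
      ENNReal.ofReal_mul (hf x), ENNReal.ofReal_toReal (π.apply_ne_top x),
      Real.enorm_of_nonneg (hf x)]
  simp only [hterm]
  exact hs.tsum_ofReal_lt_top

lemma integral_le_of_isSteadyState (hf : ∀ x, 0 ≤ f x)
    (hL : ∀ z ∈ init.support, ∀ t, (L z t).support.Finite) {C : ℝ} (hC0 : 0 ≤ C)
    (hC : ∀ z ∈ init.support, ∀ η > 0, ∀ᶠ n in atTop, cesaro (fun t => pexp (L z t) f) n ≤ C + η)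
    {π : PMF α} (hπ : IsSteadyState (fun t => init.bind (L · t)) π) :
    Integrable f π.toMeasure ∧ ∫ x, f x ∂π.toMeasure ≤ C := by
  have h := sum_le_of_isSteadyState hf hL hC0 hC hπ
  have hint := PMF.integrable_of_sum_le hf h
  refine ⟨hint, ?_⟩
  rw [PMF.integral_eq_tsum _ _ hint]
  refine Real.tsum_le_of_sum_le (fun x => mul_nonneg ENNReal.toReal_nonneg (hf x)) fun S => ?_
  simpa only [smul_eq_mul, mul_comm] using h S

/-- Pointwise convergence could lose part of the mean at infinity. The second moments exclude this:
for the finitely many initial states retained, f restricted to a finite sublevel set already has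
almost the full mean at all times. -/
lemma le_integral_of_isSteadyState (hf : ∀ x, 0 ≤ f x) (hfin : ∀ K : ℝ, {x | f x ≤ K}.Finite)
    (hL : ∀ z ∈ init.support, ∀ t, (L z t).support.Finite) {c : ℝ}
    (hr : ∀ z ∈ init.support, ∃ r, ∀ t, pexp (L z t) (fun x => f x ^ 2) ≤ r)
    (hc : ∀ z ∈ init.support, ∀ η > 0, ∀ᶠ n in atTop, c - η ≤ cesaro (fun t => pexp (L z t) f) n)
    {π : PMF α} (hπ : IsSteadyState (fun t => init.bind (L · t)) π)
    {C : ℝ} (hsum : ∀ S : Finset α, ∑ x ∈ S, f x * (π x).toReal ≤ C) :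
    c ≤ ∫ x, f x ∂π.toMeasure := by
  obtain ⟨φ, hφ, hlim⟩ := hπ
  refine le_of_forall_pos_le_add fun η hη => ?_
  obtain ⟨F, hF, hmass⟩ := init.exists_finset_mass (η := η / (3 * (|c| + 1))) (by positivity)
  choose! r hr using hr
  have hev : ∀ᶠ K : ℝ in atTop, ∀ z ∈ F, r z / K ≤ η / 3 := by
    rw [Filter.eventually_all_finset]
    intro z _
    exact ((tendsto_const_nhds (x := r z)).div_atTop tendsto_id).eventually
      (ge_mem_nhds (by positivity))
  obtain ⟨K, hK, hK0⟩ := (hev.and (eventually_gt_atTop 0)).exists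
  set S := (hfin K).toFinset with hS
  have hS_le : ∑ x ∈ S, f x * (π x).toReal ≤ ∫ x, f x ∂π.toMeasure := by
    have hpos : ∀ x, 0 ≤ f x * (π x).toReal := fun x => mul_nonneg (hf x) ENNReal.toReal_nonneg
    rw [PMF.integral_eq_tsum _ _ (PMF.integrable_of_sum_le hf hsum)]
    simp only [smul_eq_mul, mul_comm _ (f _)]
    exact (summable_of_sum_le hpos hsum).sum_le_tsum S fun x _ => hpos x
  have hevn : ∀ᶠ n in atTop, ∀ z ∈ F, c - η / 3 ≤ cesaro (fun t => pexp (L z t) f) n := by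
    rw [Filter.eventually_all_finset]
    exact fun z hz => hc z (hF z hz) _ (by positivity)
  have key : c - η ≤ ∑ x ∈ S, f x * (π x).toReal := by
    refine ge_of_tendsto (tendsto_cesaro_sum hlim S f) ?_
    filter_upwards [hφ.tendsto_atTop.eventually hevn,
      hφ.tendsto_atTop.eventually (eventually_gt_atTop 0)] with k hk hk0
    set n := φ k
    have hbound : ∀ t, ∑ z ∈ F, (init z).toReal * (pexp (L z t) f + -(η / 3)) ≤
        ∑ x ∈ S, f x * ((init.bind (L · t)) x).toReal := by
      intro t
      calc _ ≤ ∑ z ∈ F, (init z).toReal * ∑ x ∈ S, f x * (L z t x).toReal := by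
            gcongr with z hz
            have := pexp_sub_div_le (hL z (hF z hz) t) hf hf hK0 (hfin K) (r := r z)
              (by simpa [sq] using hr z (hF z hz) t)
            linarith [hK z hz]
        _ = ∑ x ∈ S, f x * ∑ z ∈ F, (init z).toReal * (L z t x).toReal := by
            simp only [Finset.mul_sum]
            rw [Finset.sum_comm]
            exact Finset.sum_congr rfl fun x _ => Finset.sum_congr rfl fun z _ => by ring
        _ ≤ _ := Finset.sum_le_sum fun x _ =>
            mul_le_mul_of_nonneg_left (init.le_bind_toReal (L · t) F x) (hf x)
    have hone := init.sum_toReal_le_one F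
    have h0 : 0 ≤ ∑ z ∈ F, (init z).toReal := Finset.sum_nonneg fun _ _ => ENNReal.toReal_nonneg
    have h1 : η / (3 * (|c| + 1)) * |c| ≤ η / 3 := by
      rw [div_mul_eq_mul_div, div_le_iff₀ (by positivity)]
      nlinarith [abs_nonneg c]
    calc c - η ≤ (∑ z ∈ F, (init z).toReal) * (c - η / 3 + -(η / 3)) := by
          set m := ∑ z ∈ F, (init z).toReal
          have h2 : (1 - m) * c ≤ η / 3 := by
            calc (1 - m) * c ≤ (1 - m) * |c| :=
                  mul_le_mul_of_nonneg_left (le_abs_self c) (by linarith)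
              _ ≤ η / (3 * (|c| + 1)) * |c| :=
                  mul_le_mul_of_nonneg_right (by linarith) (abs_nonneg c)
              _ ≤ η / 3 := h1
          nlinarith
      _ ≤ ∑ z ∈ F, (init z).toReal * cesaro (fun t => pexp (L z t) f + -(η / 3)) n := by
          rw [Finset.sum_mul]
          gcongr with z hz
          rw [cesaro_add_const _ _ hk0]
          linarith [hk z hz]
      _ = cesaro (fun t => ∑ z ∈ F, (init z).toReal * (pexp (L z t) f + -(η / 3))) n :=
          (cesaro_sum _ _ _ _).symm
      _ ≤ _ := cesaro_mono hbound n
  linarith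

end integral
end mixture

lemma isStable_of_tight {N : ℕ} {law : ℕ → PMF (Fin N → ℕ)}
    (hfin : ∀ K : ℝ, {q : Fin N → ℕ | ∑ n, (q n : ℝ) ≤ K}.Finite)
    (htight : ∀ η : ℝ, 0 < η → ∃ K : ℝ, ∀ t, 1 - η ≤ ∑ x ∈ (hfin K).toFinset, (law t x).toReal) :
    IsStable law := by
  refine le_antisymm (ENNReal.le_of_forall_pos_le_add fun η hη _ => ?_) zero_le
  obtain ⟨K, hK⟩ := htight η (by exact_mod_cast hη)
  rw [zero_add]
  refine limsup_le_of_le (by isBoundedDefault) ?_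
  filter_upwards [eventually_ge_atTop K] with C hC
  refine limsup_le_of_le (by isBoundedDefault) (Eventually.of_forall fun t => ?_)
  have hmeas : MeasurableSet {q : Fin N → ℕ | ∑ n, (q n : ℝ) ≤ K} := (hfin K).measurableSet
  calc (law t).toMeasure {q | C < ∑ n, (q n : ℝ)}
      ≤ (law t).toMeasure {q : Fin N → ℕ | ∑ n, (q n : ℝ) ≤ K}ᶜ :=
        measure_mono fun q hq => by
          simp only [Set.mem_compl_iff, Set.mem_ofPred_eq, not_le] at *
          linarith
    _ = 1 - (law t).toMeasure {q : Fin N → ℕ | ∑ n, (q n : ℝ) ≤ K} :=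
        prob_compl_eq_one_sub hmeas
    _ ≤ η := by
        have h1 : (law t).toMeasure {q : Fin N → ℕ | ∑ n, (q n : ℝ) ≤ K} =
            ENNReal.ofReal (∑ x ∈ (hfin K).toFinset, (law t x).toReal) := by
          rw [ENNReal.ofReal_sum_of_nonneg fun _ _ => ENNReal.toReal_nonneg]
          simp only [ENNReal.ofReal_toReal ((law t).apply_ne_top _)]
          rw [← PMF.toMeasure_apply_finset, Set.Finite.coe_toFinset]
        rw [h1, ← ENNReal.ofReal_one, ← ENNReal.ofReal_sub _ (by positivity)]
        refine ENNReal.ofReal_le_of_le_toReal ?_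
        simp only [ENNReal.coe_toReal]
        linarith [hK t]

/-! ### Second moments of chains with negative drift -/

/-- The corrections κ and θ M² are each at most g, so over T + 1 terms they amount to at most 2 (T +
1) g, a quarter of d₂ - T d₁, whereas the drift supplies half of it. -/
lemma exists_window_rates (T : ℕ) {M d₁ d₂ : ℝ} (hM : 0 < M)
    (hd : T * d₁ < d₂) : ∃ κ > 0, ∃ θ > 0, θ * M ≤ 1 ∧
      T * (θ * (d₁ / 2 + κ + θ * M ^ 2)) < -(θ * (-d₂ / 2 + κ + θ * M ^ 2)) := by
  set g := (d₂ - T * d₁) / (8 * (T + 1)) with hg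
  have hT : (0 : ℝ) < T + 1 := by positivity
  have hg0 : 0 < g := div_pos (by linarith) (by positivity)
  have hgT : g * (8 * (T + 1)) = d₂ - T * d₁ := by rw [hg]; field_simp
  set θ := min (1 / M) (g / M ^ 2) with hθ
  have hθ0 : 0 < θ := lt_min (by positivity) (by positivity)
  have h1 : θ * M ≤ 1 := (le_div_iff₀ hM).1 (min_le_left _ _)
  have h2 : θ * M ^ 2 ≤ g := (le_div_iff₀ (by positivity)).1 (min_le_right _ _)
  refine ⟨g, hg0, θ, hθ0, h1, ?_⟩
  have h3 : T * (d₁ / 2 + g + θ * M ^ 2) + (-d₂ / 2 + g + θ * M ^ 2) < 0 := by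
    have : (T + 1) * (θ * M ^ 2) ≤ (T + 1) * g := mul_le_mul_of_nonneg_left h2 hT.le
    have : 0 < g * (T + 1) := by positivity
    nlinarith
  nlinarith [mul_neg_of_pos_of_neg hθ0 h3]

/-- If `Y` has bounded increments, and the drift of `Y ^ 2` is at most `d₁ * Y + K` in every slot
and at most `-d₂ * Y + K` in some slot of every window of length `T`, where `T * d₁ < d₂`, then the
second moment of `Y` is eventually below a bound that does not depend on the chain. -/
lemma exists_second_moment_bound (T : ℕ) (hT : 0 < T) {M K d₁ d₂ : ℝ} (hM : 0 < M) (hK : 0 ≤ K)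
    (hd₁ : 0 ≤ d₁) (hd : T * d₁ < d₂) : ∃ C : ℝ, 0 ≤ C ∧
    ∀ {β : Type} (p : ℕ → PMF β) (k : ℕ → β → PMF β) (Y : β → ℝ),
      (∀ t, p (t + 1) = (p t).bind (k t)) → (∀ t, (p t).support.Finite) → (∀ x, 0 ≤ Y x) →
      (∀ t, ∀ x ∈ (p t).support, ∀ x' ∈ (k t x).support, |Y x' - Y x| ≤ M) →
      (∀ t, ∀ x ∈ (p t).support, pexp (k t x) (fun x' => Y x' ^ 2) - Y x ^ 2 ≤ d₁ * Y x + K) →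
      (∀ j, ∃ t, j * T ≤ t ∧ t < (j + 1) * T ∧ ∀ x ∈ (p t).support,
        pexp (k t x) (fun x' => Y x' ^ 2) - Y x ^ 2 ≤ -d₂ * Y x + K) →
      ∀ᶠ t in atTop, pexp (p t) (fun x => Y x ^ 2) ≤ C := by
  -- All constants are fixed before the chain is introduced; this is the source of the uniformity.
  obtain ⟨κ, hκ, θ, hθ, hθM, hab⟩ := exists_window_rates T hM hd
  set c := Real.exp (θ * (K / (2 * κ) + M)) with hc
  obtain ⟨C, hC0, hC⟩ := eventually_le_of_windows T hT
    (a := θ * (d₁ / 2 + κ + θ * M ^ 2)) (by positivity) hab (Real.exp_pos _).le (C := c)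
  refine ⟨2 / θ ^ 2 * C, by positivity, fun {β} p k Y hp hfin hY hincr hgen hwin => ?_⟩
  have hkfin : ∀ t, ∀ x ∈ (p t).support, (k t x).support.Finite := by
    intro t x hx
    refine (hfin (t + 1)).subset fun y hy => ?_
    rw [hp t, PMF.mem_support_bind_iff]
    exact ⟨x, hx, hy⟩
  have hstep : ∀ t r, (∀ x ∈ (p t).support,
      pexp (k t x) (fun x' => Real.exp (θ * Y x')) ≤ r * Real.exp (θ * Y x) + c) →
      pexp (p (t + 1)) (fun x => Real.exp (θ * Y x)) ≤
        r * pexp (p t) (fun x => Real.exp (θ * Y x)) + c := by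
    intro t r h
    rw [hp t, pexp_bind (hfin t) (hkfin t)]
    refine (pexp_mono (hfin t) h).trans_eq ?_
    rw [pexp_add (hfin t), pexp_const_mul, pexp_const]
  have hev := hC (fun t => pexp (p t) fun x => Real.exp (θ * Y x))
    (fun t => pexp_nonneg fun x => (Real.exp_pos _).le)
    (fun t => hstep t _ fun x hx => pexp_exp_le (hkfin t x hx) Y (hY x) hκ hK hθ hθM
      (hincr t x hx) (hgen t x hx))
    (fun j => by
      obtain ⟨t, h1, h2, h3⟩ := hwin j
      refine ⟨t, h1, h2, hstep t _ fun x hx => ?_⟩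
      rw [neg_neg]
      exact pexp_exp_le (hkfin t x hx) Y (hY x) hκ hK hθ hθM (hincr t x hx) (h3 x hx))
  filter_upwards [hev] with t ht
  -- From x² / 2 ≤ e^x with x = θ Y.
  have h1 : pexp (p t) (fun x => Y x ^ 2) ≤
      pexp (p t) fun x => 2 / θ ^ 2 * Real.exp (θ * Y x) := by
    refine pexp_mono (hfin t) fun x _ => ?_
    have := Real.quadratic_le_exp_of_nonneg (mul_nonneg hθ.le (hY x))
    have h0 := mul_nonneg hθ.le (hY x)
    rw [div_mul_eq_mul_div, le_div_iff₀ (by positivity)]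
    nlinarith
  rw [pexp_const_mul] at h1
  exact h1.trans (mul_le_mul_of_nonneg_left ht (by positivity))

/-! ### Laws with bounded support and the primitives of one slot -/

lemma BoundedBy.finite_support {ν : PMF ℕ} {B : ℕ} (h : BoundedBy ν B) : ν.support.Finite :=
  (Set.finite_Iic B).subset h

lemma pmfMean_eq_pexp {ν : PMF ℕ} (h : ν.support.Finite) :
    pmfMean ν = pexp ν fun k => (k : ℝ) := integral_eq_pexp h _

lemma pmfVar_eq_pexp {ν : PMF ℕ} (h : ν.support.Finite) :
    pmfVar ν = pexp ν (fun k => (k : ℝ) ^ 2) - pmfMean ν ^ 2 := by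
  have hm : AEMeasurable (fun k : ℕ => (k : ℝ)) ν.toMeasure :=
    (measurable_of_countable _).aemeasurable
  rw [pmfVar, variance_eq_integral hm, integral_eq_pexp h, integral_eq_pexp h, pmfMean_eq_pexp h]
  set m := pexp ν fun k => (k : ℝ)
  have : ∀ k ∈ ν.support, ((k : ℝ) - m) ^ 2 = (k : ℝ) ^ 2 + ((-(2 * m)) * k + m ^ 2) := by
    intro k _; ring
  rw [pexp_congr this, pexp_add h, pexp_add h, pexp_const_mul, pexp_const]
  ring

section primitives
variable {N : ℕ} {arr : PMF ℕ} {svc : Fin N → PMF ℕ}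

lemma serviceLaw_apply (svc : Fin N → PMF ℕ) (s : Fin N → ℕ) :
    serviceLaw svc s = ∏ n, svc n (s n) := by
  rw [serviceLaw, Measure.toPMF_apply, Measure.pi_singleton]
  exact Finset.prod_congr rfl fun n _ =>
    PMF.toMeasure_apply_singleton _ _ (measurableSet_singleton _)

lemma le_of_mem_support_serviceLaw {S : ℕ} (hS : ∀ n, BoundedBy (svc n) S) {s : Fin N → ℕ}
    (hs : s ∈ (serviceLaw svc).support) (n : Fin N) : s n ≤ S := by
  rw [PMF.mem_support_iff, serviceLaw_apply, Finset.prod_ne_zero_iff] at hs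
  exact hS n _ ((PMF.mem_support_iff _ _).2 (hs n (Finset.mem_univ n)))

lemma finite_support_serviceLaw {S : ℕ} (hS : ∀ n, BoundedBy (svc n) S) :
    (serviceLaw svc).support.Finite :=
  (Set.Finite.pi' fun _ : Fin N => Set.finite_Iic S).subset fun _ hs n =>
    le_of_mem_support_serviceLaw hS hs n

lemma pexp_serviceLaw_eval {S : ℕ} (hS : ∀ n, BoundedBy (svc n) S) (n : Fin N) :
    pexp (serviceLaw svc) (fun s => (s n : ℝ)) = pmfMean (svc n) := by
  rw [← integral_eq_pexp (finite_support_serviceLaw hS), serviceLaw, Measure.toPMF_toMeasure,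
    pmfMean, ← (measurePreserving_eval (fun n => (svc n).toMeasure) n).map_eq,
    integral_map (measurable_pi_apply n).aemeasurable]
  exact (measurable_of_countable _).aestronglyMeasurable

/-- The law of the arrivals and services of one slot. -/
noncomputable def primLaw (arr : PMF ℕ) (svc : Fin N → PMF ℕ) : PMF (ℕ × (Fin N → ℕ)) :=
  arr.bind fun a => (serviceLaw svc).map fun s => (a, s)

/-- The law of the arrivals, the services and the selected server of one slot. -/
noncomputable def slotLaw (arr : PMF ℕ) (svc : Fin N → PMF ℕ) (d : PMF (Fin N)) :
    PMF ((ℕ × (Fin N → ℕ)) × Fin N) :=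
  (primLaw arr svc).bind fun w => d.map fun n => (w, n)

/-- Arrivals are bounded by `A` and services by `S`. -/
structure PrimBounded (arr : PMF ℕ) (svc : Fin N → PMF ℕ) (A S : ℕ) : Prop where
  arr_le : BoundedBy arr A
  svc_le : ∀ n, BoundedBy (svc n) S

namespace PrimBounded
variable {A S : ℕ} (hB : PrimBounded arr svc A S)
include hB

lemma finite_primLaw : (primLaw arr svc).support.Finite :=
  PMF.finite_support_bind hB.arr_le.finite_support fun _ _ =>
    PMF.finite_support_map (finite_support_serviceLaw hB.svc_le) _

lemma finite_slotLaw (d : PMF (Fin N)) : (slotLaw arr svc d).support.Finite :=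
  PMF.finite_support_bind hB.finite_primLaw fun _ _ =>
    PMF.finite_support_map (Set.toFinite _) _

lemma of_mem_primLaw {w : ℕ × (Fin N → ℕ)} (hw : w ∈ (primLaw arr svc).support) :
    w.1 ≤ A ∧ ∀ n, w.2 n ≤ S := by
  simp only [primLaw, PMF.mem_support_bind_iff, PMF.mem_support_map_iff] at hw
  obtain ⟨a, ha, s, hs, rfl⟩ := hw
  exact ⟨hB.arr_le a ha, le_of_mem_support_serviceLaw hB.svc_le hs⟩

lemma of_mem_slotLaw {d : PMF (Fin N)} {w : (ℕ × (Fin N → ℕ)) × Fin N}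
    (hw : w ∈ (slotLaw arr svc d).support) : w.1.1 ≤ A ∧ ∀ n, w.1.2 n ≤ S := by
  simp only [slotLaw, PMF.mem_support_bind_iff, PMF.mem_support_map_iff] at hw
  obtain ⟨w, hw, n, -, rfl⟩ := hw
  exact hB.of_mem_primLaw hw

lemma pexp_primLaw (g : ℕ × (Fin N → ℕ) → ℝ) :
    pexp (primLaw arr svc) g = pexp arr fun a => pexp (serviceLaw svc) fun s => g (a, s) := by
  have hs := finite_support_serviceLaw hB.svc_le
  rw [primLaw, pexp_bind hB.arr_le.finite_support fun _ _ => PMF.finite_support_map hs _]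
  simp only [pexp_map hs]

lemma pexp_slotLaw (d : PMF (Fin N)) (g : (ℕ × (Fin N → ℕ)) × Fin N → ℝ) :
    pexp (slotLaw arr svc d) g = pexp (primLaw arr svc) fun w => pexp d fun n => g (w, n) := by
  have hd : d.support.Finite := Set.toFinite _
  rw [slotLaw, pexp_bind hB.finite_primLaw fun _ _ => PMF.finite_support_map hd _]
  simp only [pexp_map hd]

lemma pexp_slotLaw_fst (d : PMF (Fin N)) (g : ℕ × (Fin N → ℕ) → ℝ) :
    pexp (slotLaw arr svc d) (fun w => g w.1) = pexp (primLaw arr svc) g := by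
  rw [hB.pexp_slotLaw]
  simp only [pexp_const]

lemma pexp_service (n : Fin N) :
    pexp (primLaw arr svc) (fun w => (w.2 n : ℝ)) = pmfMean (svc n) := by
  rw [hB.pexp_primLaw]
  simp only [pexp_serviceLaw_eval hB.svc_le, pexp_const]

lemma pexp_arrival : pexp (primLaw arr svc) (fun w => (w.1 : ℝ)) = pmfMean arr := by
  rw [hB.pexp_primLaw]
  simp only [pexp_const]
  exact (pmfMean_eq_pexp hB.arr_le.finite_support).symm

lemma pexp_net_input :
    pexp (primLaw arr svc) (fun w => (w.1 : ℝ) - ∑ n, (w.2 n : ℝ)) =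
      pmfMean arr - ∑ n, pmfMean (svc n) := by
  have hf := hB.finite_primLaw
  rw [pexp_sub hf, hB.pexp_arrival, pexp_sum hf]
  simp only [hB.pexp_service]

/-- This second moment is the constant in the drift of both the balanced and the pooled system. Its
heavy-traffic limit depends on the arrivals only through the limiting variance and mean. -/
lemma pexp_net_input_sq :
    pexp (primLaw arr svc) (fun w => ((w.1 : ℝ) - ∑ n, (w.2 n : ℝ)) ^ 2) =
      pmfVar arr + pmfMean arr ^ 2 - 2 * pmfMean arr * ∑ n, pmfMean (svc n) +
        pexp (serviceLaw svc) (fun s => (∑ n, (s n : ℝ)) ^ 2) := by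
  have hs := finite_support_serviceLaw hB.svc_le
  have ha := hB.arr_le.finite_support
  rw [hB.pexp_primLaw]
  have hin : ∀ a : ℕ, pexp (serviceLaw svc) (fun s => ((a : ℝ) - ∑ n, (s n : ℝ)) ^ 2) =
      (a : ℝ) ^ 2 + ((-(2 * ∑ n, pmfMean (svc n))) * a +
        pexp (serviceLaw svc) (fun s => (∑ n, (s n : ℝ)) ^ 2)) := by
    intro a
    have : ∀ s ∈ (serviceLaw svc).support, ((a : ℝ) - ∑ n, (s n : ℝ)) ^ 2 =
        (a : ℝ) ^ 2 + ((-(2 * (a : ℝ))) * ∑ n, (s n : ℝ) + (∑ n, (s n : ℝ)) ^ 2) := by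
      intro s _; ring
    rw [pexp_congr this, pexp_add hs, pexp_add hs, pexp_const, pexp_const_mul, pexp_sum hs]
    simp only [pexp_serviceLaw_eval hB.svc_le]
    ring
  simp only [hin]
  rw [pexp_add ha, pexp_add ha, pexp_const_mul, pexp_const, pmfVar_eq_pexp ha, pmfMean_eq_pexp ha]
  ring

lemma pexp_routed (d : PMF (Fin N)) (i : Fin N) :
    pexp (slotLaw arr svc d) (fun w => if i = w.2 then (w.1.1 : ℝ) else 0) =
      pmfMean arr * (d i).toReal := by
  rw [hB.pexp_slotLaw]
  have h : ∀ a : ℝ, pexp d (fun n => if i = n then a else 0) = (d i).toReal * a := by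
    intro a
    rw [pexp, tsum_eq_single i]
    · simp
    · intro n hn
      simp [Ne.symm hn]
  simp only [h]
  rw [pexp_const_mul, hB.pexp_arrival, mul_comm]

/-- The policy affects the drift of the quadratic functionals only through the inner product on the
right, the quantity preserved by equivalence in inner product. -/
lemma pexp_weighted_input (d : PMF (Fin N)) (q : Fin N → ℝ) :
    pexp (slotLaw arr svc d) (fun w => ∑ i, q i * ((if i = w.2 then (w.1.1 : ℝ) else 0) - w.1.2 i)) =
      pmfMean arr * ∑ i, q i * (d i).toReal - ∑ i, q i * pmfMean (svc i) := by
  have hf := hB.finite_slotLaw d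
  rw [pexp_sum hf, Finset.mul_sum, ← Finset.sum_sub_distrib]
  refine Finset.sum_congr rfl fun i _ => ?_
  rw [pexp_const_mul, pexp_sub hf, hB.pexp_routed,
    hB.pexp_slotLaw_fst d (fun w => (w.2 i : ℝ)), hB.pexp_service]
  ring

end PrimBounded
end primitives

/-! ### Total queue length, squared norm, and squared distance from the diagonal -/

section functionals
variable {N : ℕ}

/-- Total queue length. -/
noncomputable def totalQueue (q : Fin N → ℕ) : ℝ := ∑ n, (q n : ℝ)

/-- Squared Euclidean norm of the queue length vector. -/
noncomputable def sqQueue (q : Fin N → ℕ) : ℝ := ∑ n, (q n : ℝ) ^ 2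

/-- Squared distance of the queue length vector from the diagonal. -/
noncomputable def devQueue (q : Fin N → ℕ) : ℝ := ∑ n, ((q n : ℝ) - totalQueue q / N) ^ 2

lemma totalQueue_nonneg (q : Fin N → ℕ) : 0 ≤ totalQueue q :=
  Finset.sum_nonneg fun _ _ => Nat.cast_nonneg _

lemma sqQueue_nonneg (q : Fin N → ℕ) : 0 ≤ sqQueue q :=
  Finset.sum_nonneg fun _ _ => sq_nonneg _

lemma devQueue_nonneg (q : Fin N → ℕ) : 0 ≤ devQueue q :=
  Finset.sum_nonneg fun _ _ => sq_nonneg _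

lemma devQueue_eq (hN : 0 < N) (q : Fin N → ℕ) :
    devQueue q = sqQueue q - totalQueue q ^ 2 / N := by
  have hN' : (N : ℝ) ≠ 0 := by positivity
  have : ∀ n, ((q n : ℝ) - totalQueue q / N) ^ 2 =
      (q n : ℝ) ^ 2 - 2 * (totalQueue q / N) * q n + (totalQueue q / N) ^ 2 := fun n => by ring
  simp only [devQueue, this, Finset.sum_add_distrib, Finset.sum_sub_distrib, ← Finset.mul_sum]
  change sqQueue q - 2 * (totalQueue q / N) * totalQueue q + _ = _
  simp only [Finset.sum_const, Finset.card_univ, Fintype.card_fin, nsmul_eq_mul]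
  field_simp
  ring

lemma totalQueue_sq_le (q : Fin N → ℕ) : totalQueue q ^ 2 ≤ N * sqQueue q := by
  have := sq_sum_le_card_mul_sum_sq (s := Finset.univ) (f := fun n => (q n : ℝ))
  simpa [totalQueue, sqQueue] using this

lemma sqrt_sqQueue_le (q : Fin N → ℕ) : √(sqQueue q) ≤ totalQueue q := by
  rw [Real.sqrt_le_left (totalQueue_nonneg q)]
  exact Finset.sum_sq_le_sq_sum_of_nonneg fun _ _ => Nat.cast_nonneg _

lemma finite_totalQueue_le (K : ℝ) : {q : Fin N → ℕ | totalQueue q ≤ K}.Finite := by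
  refine (Set.Finite.pi' fun _ : Fin N => Set.finite_Iic ⌊K⌋₊).subset fun q hq n => ?_
  refine Nat.le_floor (le_trans ?_ (hq : totalQueue q ≤ K))
  exact Finset.single_le_sum (f := fun n => (q n : ℝ)) (fun _ _ => Nat.cast_nonneg _)
    (Finset.mem_univ n)

lemma abs_sub_le_sqrt_devQueue (q : Fin N → ℕ) (n : Fin N) :
    |(q n : ℝ) - totalQueue q / N| ≤ √(devQueue q) :=
  Real.abs_le_sqrt (Finset.single_le_sum
    (f := fun n => ((q n : ℝ) - totalQueue q / N) ^ 2) (fun _ _ => sq_nonneg _) (Finset.mem_univ n))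

/-- If some queue is empty, the total queue length is controlled by the distance from the
diagonal. -/
lemma totalQueue_sq_le_of_eq_zero (hN : 0 < N) {q : Fin N → ℕ} {n : Fin N} (hn : q n = 0) :
    totalQueue q ^ 2 ≤ N ^ 2 * devQueue q := by
  have h := abs_sub_le_sqrt_devQueue q n
  have hN' : (0 : ℝ) < N := by positivity
  rw [hn, Nat.cast_zero, zero_sub, abs_neg,
    abs_of_nonneg (div_nonneg (totalQueue_nonneg q) hN'.le), div_le_iff₀ hN'] at h
  calc totalQueue q ^ 2 ≤ (√(devQueue q) * N) ^ 2 :=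
        pow_le_pow_left₀ (totalQueue_nonneg q) h 2
    _ = N ^ 2 * devQueue q := by rw [mul_pow, Real.sq_sqrt (devQueue_nonneg q)]; ring

/-- The reverse triangle inequality for the Euclidean norm; the factor √N is relaxed to N. -/
lemma abs_sqrt_sum_sq_sub_le (x y : Fin N → ℝ) {c : ℝ} (hc : 0 ≤ c) (h : ∀ n, |x n - y n| ≤ c) :
    |√(∑ n, x n ^ 2) - √(∑ n, y n ^ 2)| ≤ N * c := by
  have hnorm : ∀ z : Fin N → ℝ, √(∑ n, z n ^ 2) = ‖WithLp.toLp 2 z‖ := by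
    intro z
    simp [EuclideanSpace.norm_eq]
  rw [hnorm, hnorm]
  refine (abs_norm_sub_norm_le _ _).trans ?_
  rw [← WithLp.toLp_sub, ← hnorm, Real.sqrt_le_left (by positivity)]
  have h1 : ∑ n, (x - y) n ^ 2 ≤ ∑ _n : Fin N, c ^ 2 := by
    refine Finset.sum_le_sum fun n _ => ?_
    rw [Pi.sub_apply, ← sq_abs]
    exact pow_le_pow_left₀ (abs_nonneg _) (h n) 2
  refine h1.trans ?_
  have h2 : (N : ℝ) ≤ (N : ℝ) ^ 2 := by
    exact_mod_cast Nat.le_self_pow two_ne_zero N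
  simp only [Finset.sum_const, Finset.card_univ, Fintype.card_fin, nsmul_eq_mul, mul_pow]
  exact mul_le_mul_of_nonneg_right h2 (sq_nonneg c)

lemma abs_sqrt_sqQueue_sub_le (q q' : Fin N → ℕ) {c : ℝ} (hc : 0 ≤ c)
    (h : ∀ n, |(q' n : ℝ) - q n| ≤ c) : |√(sqQueue q') - √(sqQueue q)| ≤ N * c :=
  abs_sqrt_sum_sq_sub_le _ _ hc h

lemma abs_sqrt_devQueue_sub_le (hN : 0 < N) (q q' : Fin N → ℕ) {c : ℝ} (hc : 0 ≤ c)
    (h : ∀ n, |(q' n : ℝ) - q n| ≤ c) : |√(devQueue q') - √(devQueue q)| ≤ N * (2 * c) := by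
  refine abs_sqrt_sum_sq_sub_le _ _ (by positivity) fun n => ?_
  have hN' : (0 : ℝ) < N := by positivity
  have ht : |totalQueue q' / N - totalQueue q / N| ≤ c := by
    rw [← sub_div, abs_div, abs_of_pos hN', div_le_iff₀ hN', totalQueue, totalQueue,
      ← Finset.sum_sub_distrib]
    refine (Finset.abs_sum_le_sum_abs _ _).trans ((Finset.sum_le_sum fun n _ => h n).trans_eq ?_)
    simp [mul_comm]
  have := h n
  rw [abs_le] at *
  constructor <;> linarith [this.1, this.2, ht.1, ht.2]

/-! ### One slot -/

/-- `Q_i + A_i - S_i`, the next queue length before truncation at zero. -/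
noncomputable def netQueue (q : Fin N → ℕ) (n : Fin N) (a : ℕ) (s : Fin N → ℕ) (i : Fin N) : ℝ :=
  (q i : ℝ) + ((if i = n then (a : ℝ) else 0) - s i)

variable (q : Fin N → ℕ) (n : Fin N) (a : ℕ) (s : Fin N → ℕ)

lemma nextQueue_cast (i : Fin N) :
    ((nextQueue q n a s i : ℕ) : ℝ) = max (netQueue q n a s i) 0 := by
  have h : netQueue q n a s i = ((q i + if i = n then a else 0 : ℕ) : ℝ) - s i := by
    rw [netQueue]; push_cast; ring
  rw [h, nextQueue]
  rcases le_total (s i) (q i + if i = n then a else 0) with h1 | h1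
  · rw [Nat.cast_sub h1, max_eq_left]
    exact sub_nonneg.2 (by exact_mod_cast h1)
  · rw [Nat.sub_eq_zero_of_le h1, max_eq_right]
    · simp
    · exact sub_nonpos.2 (by exact_mod_cast h1)

lemma sum_netQueue :
    ∑ i, netQueue q n a s i = totalQueue q + ((a : ℝ) - ∑ i, (s i : ℝ)) := by
  simp only [netQueue, Finset.sum_add_distrib, Finset.sum_sub_distrib, totalQueue]
  simp

variable {A S : ℕ} {a s}

lemma abs_net_le (ha : a ≤ A) (hs : ∀ i, s i ≤ S) (i : Fin N) :
    |(if i = n then (a : ℝ) else 0) - s i| ≤ A + S := by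
  have h1 : (a : ℝ) ≤ A := by exact_mod_cast ha
  have h2 : (s i : ℝ) ≤ S := by exact_mod_cast hs i
  have h3 : (0 : ℝ) ≤ a := Nat.cast_nonneg _
  have h4 : (0 : ℝ) ≤ s i := Nat.cast_nonneg _
  rw [abs_le]
  split_ifs <;> constructor <;> linarith

lemma abs_nextQueue_sub_le (ha : a ≤ A) (hs : ∀ i, s i ≤ S) (i : Fin N) :
    |((nextQueue q n a s i : ℕ) : ℝ) - q i| ≤ A + S := by
  have h := abs_net_le n ha hs i
  rw [nextQueue_cast]
  have hq : (0 : ℝ) ≤ q i := Nat.cast_nonneg _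
  rw [abs_le] at *
  rcases max_cases (netQueue q n a s i) 0 with ⟨h1, h2⟩ | ⟨h1, h2⟩ <;> rw [h1] <;>
    simp only [netQueue] at * <;> constructor <;> linarith [h.1, h.2]

/-- Truncation at zero can only decrease squares, so the untruncated square is expanded. -/
lemma sqQueue_nextQueue_le (ha : a ≤ A) (hs : ∀ i, s i ≤ S) :
    sqQueue (nextQueue q n a s) ≤ sqQueue q +
      (2 * ∑ i, (q i : ℝ) * ((if i = n then (a : ℝ) else 0) - s i) + N * ((A : ℝ) + S) ^ 2) := by
  have h : ∀ i, ((nextQueue q n a s i : ℕ) : ℝ) ^ 2 ≤ (q i : ℝ) ^ 2 +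
      (2 * ((q i : ℝ) * ((if i = n then (a : ℝ) else 0) - s i)) + ((A : ℝ) + S) ^ 2) := by
    intro i
    have h1 : ((nextQueue q n a s i : ℕ) : ℝ) ^ 2 ≤ netQueue q n a s i ^ 2 := by
      rw [nextQueue_cast]
      rcases max_cases (netQueue q n a s i) 0 with ⟨h1, h2⟩ | ⟨h1, h2⟩ <;> rw [h1]
      nlinarith [sq_nonneg (netQueue q n a s i)]
    have h2 : ((if i = n then (a : ℝ) else 0) - s i) ^ 2 ≤ ((A : ℝ) + S) ^ 2 := by
      rw [← sq_abs]
      exact pow_le_pow_left₀ (abs_nonneg _) (abs_net_le n ha hs i) 2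
    rw [netQueue] at h1
    linarith
  have := Finset.sum_le_sum fun i (_ : i ∈ Finset.univ) => h i
  simpa [sqQueue, Finset.sum_add_distrib, Finset.mul_sum] using this

variable (a s) in
lemma le_totalQueue_nextQueue :
    totalQueue q + ((a : ℝ) - ∑ i, (s i : ℝ)) ≤ totalQueue (nextQueue q n a s) := by
  rw [← sum_netQueue q n a s, totalQueue]
  exact Finset.sum_le_sum fun i _ => by rw [nextQueue_cast]; exact le_max_left _ _

/-- By `devQueue_eq` it remains to bound the new squared total from below, via X'² ≥ X² + 2X(X' - X)
and the fact that truncation only increases X'. -/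
lemma devQueue_nextQueue_le (hN : 0 < N) (ha : a ≤ A) (hs : ∀ i, s i ≤ S) :
    devQueue (nextQueue q n a s) ≤ devQueue q +
      (2 * ∑ i, (q i : ℝ) * ((if i = n then (a : ℝ) else 0) - s i) + N * ((A : ℝ) + S) ^ 2 +
        -(2 * totalQueue q / N) * ((a : ℝ) - ∑ i, (s i : ℝ))) := by
  have hN' : (0 : ℝ) < N := by positivity
  rw [devQueue_eq hN, devQueue_eq hN]
  have h1 := sqQueue_nextQueue_le q n ha hs
  have h2 := le_totalQueue_nextQueue q n a s
  have h3 : totalQueue q ^ 2 + 2 * totalQueue q * ((a : ℝ) - ∑ i, (s i : ℝ)) ≤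
      totalQueue (nextQueue q n a s) ^ 2 := by
    nlinarith [totalQueue_nonneg q, sq_nonneg (totalQueue (nextQueue q n a s) - totalQueue q)]
  have h4 := div_le_div_of_nonneg_right h3 hN'.le
  have h5 : (totalQueue q ^ 2 + 2 * totalQueue q * ((a : ℝ) - ∑ i, (s i : ℝ))) / N =
      totalQueue q ^ 2 / N - -(2 * totalQueue q / N) * ((a : ℝ) - ∑ i, (s i : ℝ)) := by
    field_simp; ring
  rw [h5] at h4
  linarith

/-- The unused service of a slot. -/
lemma unused_service_bounds (hN : 0 < N) (hs : ∀ i, s i ≤ S) {u : ℝ}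
    (hu : u = totalQueue (nextQueue q n a s) - (totalQueue q + ((a : ℝ) - ∑ i, (s i : ℝ)))) :
    0 ≤ u ∧ u ≤ N * S ∧
      (u ≠ 0 → totalQueue (nextQueue q n a s) ^ 2 ≤ N ^ 2 * devQueue (nextQueue q n a s)) := by
  have hu' : u = ∑ i, (max (netQueue q n a s i) 0 - netQueue q n a s i) := by
    rw [hu, Finset.sum_sub_distrib, sum_netQueue]
    simp only [totalQueue, nextQueue_cast]
  have hle : ∀ i, max (netQueue q n a s i) 0 - netQueue q n a s i ≤ S := by
    intro i
    have h2 : (s i : ℝ) ≤ S := by exact_mod_cast hs i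
    have h3 : (0 : ℝ) ≤ if i = n then (a : ℝ) else 0 := by split_ifs <;> positivity
    have h4 : (0 : ℝ) ≤ q i := Nat.cast_nonneg _
    have h5 : (0 : ℝ) ≤ S := Nat.cast_nonneg _
    rcases max_cases (netQueue q n a s i) 0 with ⟨h1, -⟩ | ⟨h1, -⟩ <;> rw [h1]
    · linarith
    · rw [netQueue]; linarith
  refine ⟨?_, ?_, fun hne => ?_⟩
  · rw [hu']
    exact Finset.sum_nonneg fun i _ => sub_nonneg.2 (le_max_left _ _)
  · rw [hu']
    refine (Finset.sum_le_sum fun i _ => hle i).trans_eq ?_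
    simp
  -- A server with unused service leaves its queue empty at the end of the slot.
  · rw [hu'] at hne
    obtain ⟨i, -, hi⟩ := Finset.exists_ne_zero_of_sum_ne_zero hne
    refine totalQueue_sq_le_of_eq_zero hN (n := i) ?_
    have : ((nextQueue q n a s i : ℕ) : ℝ) = 0 := by
      rw [nextQueue_cast]
      rcases max_cases (netQueue q n a s i) 0 with ⟨h1, -⟩ | ⟨h1, -⟩
      · exact absurd (by rw [h1, sub_self]) hi
      · exact h1
    exact_mod_cast this

end functionals

/-- The change of the square of the total queue length `x` to `x'`, when `y` is the net input and
the unused service `x' - (x + y)` vanishes unless `x' ^ 2 ≤ v`. -/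
lemma total_sq_change_bounds {x x' y v M ε : ℝ} (hε : 0 < ε) (hx' : 0 ≤ x') (hv : 0 ≤ v)
    (h0 : 0 ≤ x' - (x + y)) (hM : x' - (x + y) ≤ M) (hne : x' - (x + y) ≠ 0 → x' ^ 2 ≤ v) :
    -(M * (x' - (x + y))) ≤ x' ^ 2 - (x + y) ^ 2 ∧
      x' ^ 2 - (x + y) ^ 2 ≤ √ε * v + M / √ε * (x' - (x + y)) := by
  set u := x' - (x + y) with hu
  have hxy : x + y = x' - u := by rw [hu]; ring
  have hs : 0 < √ε := Real.sqrt_pos.2 hε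
  rw [hxy]
  constructor
  · nlinarith
  · by_cases h : u = 0
    · rw [h]; simp; positivity
    · have h1 := hne h
      -- The weight √ε balances the two errors: the mean of v stays bounded and that of u is ε in
      -- the long run, so both terms become O(√ε).
      have h2 : 2 * x' * u ≤ √ε * x' ^ 2 + u ^ 2 / √ε := by
        have h3 : 0 ≤ (√ε * x' - u) ^ 2 / √ε := by positivity
        have h4 : (√ε * x' - u) ^ 2 / √ε = √ε * x' ^ 2 - 2 * x' * u + u ^ 2 / √ε := by
          field_simp
          ring
        linarith
      have h5 : u ^ 2 / √ε ≤ M / √ε * u := by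
        rw [div_mul_eq_mul_div]
        refine div_le_div_of_nonneg_right ?_ hs.le
        nlinarith
      have h6 := mul_le_mul_of_nonneg_left h1 hs.le
      nlinarith [sq_nonneg u]

/-! ### Tilted dispatching distributions -/

section tilt
variable {N : ℕ} {μ : Fin N → ℝ} {q : Fin N → ℕ} {p : PMF (Fin N)}

lemma HoldsUpToEquiv.mono {X Y : Equiv.Perm (Fin N) → (Fin N → ℝ) → Prop}
    (h : ∀ σ P, X σ P → Y σ P) (hX : HoldsUpToEquiv X q p) : HoldsUpToEquiv Y q p := by
  obtain ⟨σ, h1, P, h2, h3, h4⟩ := hX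
  exact ⟨σ, h1, P, h2, h3, h _ _ h4⟩

lemma InnerEquiv.sum_eq {σ : Equiv.Perm (Fin N)} {P : Fin N → ℝ}
    (h : InnerEquiv q σ (sortedProb σ p) P) (μ : Fin N → ℝ) :
    ∑ i, (q i : ℝ) * (p i).toReal - (∑ i, (q i : ℝ) * μ i) / ∑ i, μ i =
      ∑ n, (q (σ n) : ℝ) * tiltGap μ σ P n := by
  have h1 : ∑ i, (q i : ℝ) * (p i).toReal = ∑ n, (q (σ n) : ℝ) * P n := by
    rw [← h]
    exact (Equiv.sum_comp σ fun i => (q i : ℝ) * (p i).toReal).symm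
  have h2 : ∑ i, (q i : ℝ) * μ i = ∑ n, (q (σ n) : ℝ) * μ (σ n) :=
    (Equiv.sum_comp σ fun i => (q i : ℝ) * μ i).symm
  rw [h1, h2, Finset.sum_div, ← Finset.sum_sub_distrib]
  exact Finset.sum_congr rfl fun n _ => by rw [tiltGap]; ring

lemma sum_tiltGap (hμ : ∑ i, μ i ≠ 0) (σ : Equiv.Perm (Fin N)) {P : Fin N → ℝ}
    (hP : P ∈ stdSimplex ℝ (Fin N)) : ∑ n, tiltGap μ σ P n = 0 := by
  simp only [tiltGap, Finset.sum_sub_distrib, hP.2, ← Finset.sum_div]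
  rw [Equiv.sum_comp σ μ, div_self hμ, sub_self]

/-- Relative to a pivot, every position contributes a nonpositive term. -/
lemma IsTilted.exists_pivot {σ : Equiv.Perm (Fin N)} {P : Fin N → ℝ}
    (hσ : Monotone fun n => q (σ n)) (h : IsTilted μ σ P) :
    ∃ k : Fin N, ∀ n, ((q (σ n) : ℝ) - q (σ k)) * tiltGap μ σ P n ≤ 0 := by
  obtain ⟨k, hk2, hkN, hlt, hge⟩ := h
  -- The index k - 1 is the one-based position k, the first at which the gap is required to be
  -- nonpositive.
  refine ⟨⟨k - 1, by omega⟩, fun n => ?_⟩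
  rcases lt_or_ge (n.val + 1) k with hn | hn
  · have : q (σ n) ≤ q (σ ⟨k - 1, by omega⟩) := hσ (Fin.le_def.2 (by simp; omega))
    have h1 : (q (σ n) : ℝ) ≤ q (σ ⟨k - 1, by omega⟩) := by exact_mod_cast this
    exact mul_nonpos_of_nonpos_of_nonneg (by linarith) (hlt n hn)
  · have : q (σ ⟨k - 1, by omega⟩) ≤ q (σ n) := hσ (Fin.le_def.2 (by simp; omega))
    have h1 : (q (σ ⟨k - 1, by omega⟩) : ℝ) ≤ q (σ n) := by exact_mod_cast this
    exact mul_nonpos_of_nonneg_of_nonpos (by linarith) (hge n hn)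

/-- Used with w = Δ, whose entries sum to zero, to measure queue lengths relative to the pivot. -/
lemma sum_mul_sub_pivot {x w : Fin N → ℝ} (hw : ∑ n, w n = 0) (c : ℝ) :
    ∑ n, x n * w n = ∑ n, (x n - c) * w n := by
  simp only [sub_mul, Finset.sum_sub_distrib, ← Finset.mul_sum, hw, mul_zero, sub_zero]

lemma HoldsUpToEquiv.two_le (h : HoldsUpToEquiv (IsTilted μ) q p) : 2 ≤ N := by
  obtain ⟨-, -, -, -, -, k, h1, h2, -⟩ := h
  omega

/-- The difference of the two sides is ∑ (q_n - q_k) Δ_n over sorted positions, with pivot k: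
shorter queues have Δ ≥ 0 and longer ones Δ ≤ 0, so no term is positive. -/
lemma HoldsUpToEquiv.sum_le (hμ : ∑ i, μ i ≠ 0) (h : HoldsUpToEquiv (IsTilted μ) q p) :
    ∑ i, (q i : ℝ) * (p i).toReal ≤ (∑ i, (q i : ℝ) * μ i) / ∑ i, μ i := by
  obtain ⟨σ, hσ, P, hP, he, ht⟩ := h
  obtain ⟨k, hk⟩ := ht.exists_pivot hσ
  rw [← sub_nonpos, he.sum_eq, sum_mul_sub_pivot (sum_tiltGap hμ σ hP) (q (σ k) : ℝ)]
  exact Finset.sum_nonpos fun n _ => hk n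

/-- The mean lies between the extremes, so each coordinate deviates from it by at most the range D.
-/
lemma sqrt_devQueue_le_of_extremes {D : ℝ} {i j : Fin N} (hN : 0 < N)
    (h : ∀ l, (q i : ℝ) ≤ q l ∧ (q l : ℝ) ≤ q j) (hD : D = (q j : ℝ) - q i) :
    √(devQueue q) ≤ N * D := by
  have hN' : (0 : ℝ) < N := by positivity
  have hD0 : 0 ≤ D := by rw [hD]; linarith [(h i).2]
  have h1 : (q i : ℝ) ≤ totalQueue q / N := by
    rw [le_div_iff₀ hN']
    have := Finset.sum_le_sum fun l (_ : l ∈ Finset.univ) => (h l).1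
    simpa [mul_comm, totalQueue] using this
  have h2 : totalQueue q / N ≤ q j := by
    rw [div_le_iff₀ hN']
    have := Finset.sum_le_sum fun l (_ : l ∈ Finset.univ) => (h l).2
    simpa [mul_comm, totalQueue] using this
  have h3 := abs_sqrt_sum_sq_sub_le (fun l => (q l : ℝ) - totalQueue q / N) 0 hD0 fun l => by
    have := h l
    simp only [Pi.zero_apply, sub_zero]
    rw [abs_le]
    constructor <;> linarith
  simp only [Pi.zero_apply] at h3
  have := (abs_le.1 h3).2
  simpa [devQueue] using this

/-- Every term relative to the pivot k is nonpositive, so only the first and last are kept. They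
contribute at most -δ(q_k - q_min) - δ(q_max - q_k): the pivot cancels, and the range dominates the
deviation. -/
lemma HoldsUpToEquiv.sum_le_of_delta (hμ : ∑ i, μ i ≠ 0) {δ : ℝ} (hδ : 0 ≤ δ)
    (h : HoldsUpToEquiv (IsDeltaTilted μ δ) q p) :
    ∑ i, (q i : ℝ) * (p i).toReal ≤
      (∑ i, (q i : ℝ) * μ i) / ∑ i, μ i - δ / N * √(devQueue q) := by
  have hN2 : 2 ≤ N := (h.mono fun _ _ h => h.1).two_le
  obtain ⟨σ, hσ, P, hP, he, ht, hfirst, hlast⟩ := h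
  obtain ⟨k, hk⟩ := ht.exists_pivot hσ
  have hN' : (0 : ℝ) < N := by
    have : 0 < N := by omega
    exact_mod_cast this
  set i : Fin N := ⟨0, by omega⟩
  set j : Fin N := ⟨N - 1, by omega⟩
  have hij : i ≠ j := by simp [i, j, Fin.ext_iff]; omega
  have hext : ∀ l, (q (σ i) : ℝ) ≤ q (σ l) ∧ (q (σ l) : ℝ) ≤ q (σ j) := by
    intro l
    have h1 : q (σ i) ≤ q (σ l) := hσ (Fin.le_def.2 (by simp [i]))
    have h2 : q (σ l) ≤ q (σ j) := hσ (Fin.le_def.2 (by simp [j]; omega))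
    exact ⟨by exact_mod_cast h1, by exact_mod_cast h2⟩
  have hext' : ∀ l, (q (σ i) : ℝ) ≤ q l ∧ (q l : ℝ) ≤ q (σ j) := by
    intro l
    simpa using hext (σ.symm l)
  have hdev := sqrt_devQueue_le_of_extremes (D := (q (σ j) : ℝ) - q (σ i)) (by omega) hext' rfl
  have hsum : ∑ n, (q (σ n) : ℝ) * tiltGap μ σ P n ≤ -(δ * ((q (σ j) : ℝ) - q (σ i))) := by
    rw [sum_mul_sub_pivot (sum_tiltGap hμ σ hP) (q (σ k) : ℝ)]
    have h1 : ∑ n, ((q (σ n) : ℝ) - q (σ k)) * tiltGap μ σ P n ≤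
        ∑ n ∈ {i, j}, ((q (σ n) : ℝ) - q (σ k)) * tiltGap μ σ P n := by
      rw [← neg_le_neg_iff, ← Finset.sum_neg_distrib, ← Finset.sum_neg_distrib]
      exact Finset.sum_le_sum_of_subset_of_nonneg (Finset.subset_univ _)
        fun n _ _ => neg_nonneg.2 (hk n)
    rw [Finset.sum_pair hij] at h1
    have h2 := hfirst i (by simp [i])
    have h3 := hlast j (by simp [j]; omega)
    have h4 := hext k
    nlinarith [mul_le_mul_of_nonneg_left h2 (sub_nonneg.2 h4.1),
      mul_le_mul_of_nonneg_left h3 (sub_nonneg.2 h4.2)]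
  rw [← he.sum_eq] at hsum
  have h5 : δ / N * √(devQueue q) ≤ δ * ((q (σ j) : ℝ) - q (σ i)) := by
    rw [div_mul_eq_mul_div, div_le_iff₀ hN']
    nlinarith
  linarith

/-- The plain average of the queues exceeds their `μ`-weighted average by at most the distance from
the diagonal. -/
lemma average_sub_le (hμ : ∀ n, 0 < μ n) (hN : 0 < N) (q : Fin N → ℕ) :
    totalQueue q / N - (∑ i, (q i : ℝ) * μ i) / ∑ i, μ i ≤ √(devQueue q) := by
  have : Nonempty (Fin N) := ⟨⟨0, hN⟩⟩
  have hpos : 0 < ∑ i, μ i := Finset.sum_pos (fun i _ => hμ i) Finset.univ_nonempty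
  rw [sub_le_iff_le_add, ← sub_le_iff_le_add', le_div_iff₀ hpos, Finset.mul_sum]
  -- Compared term by term: each queue is at least the plain average minus the deviation.
  refine Finset.sum_le_sum fun i _ => mul_le_mul_of_nonneg_right ?_ (hμ i).le
  have := (abs_le.1 (abs_sub_le_sqrt_devQueue q i)).1
  linarith

end tilt

/-! ### The drift of the total queue length -/

/-- Taking means in `total_sq_change_bounds`; the expression E X' - x + ε is the mean unused
service, because the net input has mean -ε. -/
lemma pexp_total_sq_bounds {Ω : Type*} {ν : PMF Ω} (hν : ν.support.Finite) {X' y v : Ω → ℝ}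
    {x M ε : ℝ} (hε : 0 < ε) (hX : ∀ w, 0 ≤ X' w) (hv : ∀ w, 0 ≤ v w)
    (hu : ∀ w ∈ ν.support, 0 ≤ X' w - (x + y w) ∧ X' w - (x + y w) ≤ M ∧
      (X' w - (x + y w) ≠ 0 → X' w ^ 2 ≤ v w)) (hy : pexp ν y = -ε) :
    -(M * (pexp ν X' - x + ε)) ≤
        pexp ν (fun w => X' w ^ 2) - x ^ 2 + 2 * ε * x - pexp ν (fun w => y w ^ 2) ∧
      pexp ν (fun w => X' w ^ 2) - x ^ 2 + 2 * ε * x - pexp ν (fun w => y w ^ 2) ≤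
        √ε * pexp ν v + M / √ε * (pexp ν X' - x + ε) := by
  have hsq : pexp ν (fun w => X' w ^ 2 - (x + y w) ^ 2) =
      pexp ν (fun w => X' w ^ 2) - x ^ 2 + 2 * ε * x - pexp ν (fun w => y w ^ 2) := by
    have : ∀ w ∈ ν.support, X' w ^ 2 - (x + y w) ^ 2 =
        X' w ^ 2 - (x ^ 2 + (2 * x * y w + y w ^ 2)) := fun w _ => by ring
    rw [pexp_congr this, pexp_sub hν, pexp_add hν, pexp_add hν, pexp_const, pexp_const_mul, hy]
    ring
  have hun : pexp ν (fun w => X' w - (x + y w)) = pexp ν X' - x + ε := by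
    rw [pexp_sub hν, pexp_add hν, pexp_const, hy]
    ring
  have hpt := fun w hw => total_sq_change_bounds hε (hX w) (hv w) (hu w hw).1 (hu w hw).2.1
    (hu w hw).2.2
  rw [← hsq, ← hun]
  constructor
  · have := pexp_mono hν fun w hw => (hpt w hw).1
    have e : ∀ w ∈ ν.support, -(M * (X' w - (x + y w))) = -M * (X' w - (x + y w)) :=
      fun w _ => by ring
    rw [pexp_congr e, pexp_const_mul] at this
    linarith
  · have := pexp_mono hν fun w hw => (hpt w hw).2
    rwa [pexp_add hν, pexp_const_mul, pexp_const_mul] at this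

lemma cesaro_total_bounds {β : Type*} {p : ℕ → PMF β} {k : ℕ → β → PMF β}
    (hp : ∀ t, p (t + 1) = (p t).bind (k t)) (hfin : ∀ t, (p t).support.Finite) {X V : β → ℝ}
    (hX : ∀ x, 0 ≤ X x) {ε M c G r Cv : ℝ} (hε : 0 < ε) (hM : 0 ≤ M) (hc : 0 ≤ c)
    (hr : ∀ t, pexp (p t) (fun x => X x ^ 2) ≤ r) (hv : ∀ᶠ t in atTop, pexp (p t) V ≤ Cv)
    (hdrift : ∀ t, ∀ x ∈ (p t).support,
      -(M * (pexp (k t x) X - X x + ε)) ≤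
        pexp (k t x) (fun x' => X x' ^ 2) - X x ^ 2 + 2 * ε * X x - G ∧
      pexp (k t x) (fun x' => X x' ^ 2) - X x ^ 2 + 2 * ε * X x - G ≤
        √ε * c * pexp (k t x) V + M / √ε * (pexp (k t x) X - X x + ε)) :
    ∀ η > 0, ∀ᶠ n in atTop, (G - M * ε) / (2 * ε) - η ≤ cesaro (fun t => pexp (p t) X) n ∧
      cesaro (fun t => pexp (p t) X) n ≤ (G + √ε * (c * Cv + M)) / (2 * ε) + η := by
  have hkfin : ∀ t, ∀ x ∈ (p t).support, (k t x).support.Finite := by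
    intro t x hx
    refine (hfin (t + 1)).subset fun y hy => ?_
    rw [hp t, PMF.mem_support_bind_iff]
    exact ⟨x, hx, hy⟩
  have hsucc : ∀ t (g : β → ℝ), pexp (p (t + 1)) g = pexp (p t) fun x => pexp (k t x) g := by
    intro t g
    rw [hp t, pexp_bind (hfin t) (hkfin t)]
  have hu : ∀ t, pexp (p t) (fun x => pexp (k t x) X - X x + ε) =
      pexp (p (t + 1)) X - pexp (p t) X + ε := by
    intro t
    rw [pexp_add (hfin t), pexp_sub (hfin t), pexp_const, hsucc]
  have hsq : ∀ t, pexp (p t)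
      (fun x => pexp (k t x) (fun x' => X x' ^ 2) - X x ^ 2 + 2 * ε * X x - G) =
      pexp (p (t + 1)) (fun x => X x ^ 2) - pexp (p t) (fun x => X x ^ 2) +
        2 * ε * pexp (p t) X - G := by
    intro t
    rw [pexp_sub (hfin t), pexp_add (hfin t), pexp_sub (hfin t), pexp_const, pexp_const_mul, hsucc]
  -- With X ≤ X² + 1, the value r + 1 bounds both the first and the second moments.
  refine cesaro_mean_bounds (b := fun t => pexp (p t) fun x => X x ^ 2)
    (v := fun t => pexp (p t) V) (r := r + 1) hε hM hc
    (fun t => pexp_nonneg fun x => sq_nonneg _) (fun t => pexp_nonneg hX)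
    (fun t => (hr t).trans (by linarith)) (fun t => ?_) hv (fun t => ?_) (fun t => ?_)
  · have h1 : pexp (p t) X ≤ pexp (p t) fun x => X x ^ 2 + 1 :=
      pexp_mono (hfin t) fun x _ => by nlinarith [sq_nonneg (X x - 1)]
    rw [pexp_add (hfin t), pexp_const] at h1
    linarith [hr t]
  · have := pexp_mono (hfin t) fun x hx => (hdrift t x hx).1
    have e : ∀ x ∈ (p t).support, -(M * (pexp (k t x) X - X x + ε)) =
      -M * (pexp (k t x) X - X x + ε) := fun x _ => by ring
    rw [pexp_congr e, pexp_const_mul, hu, hsq] at this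
    linarith
  · have := pexp_mono (hfin t) fun x hx => (hdrift t x hx).2
    rwa [pexp_add (hfin t), pexp_const_mul, pexp_const_mul, hu, hsq, ← hsucc] at this

/-! ### The chain of a dispatching rule -/

section chain
variable {N : ℕ} {arr : PMF ℕ} {svc : Fin N → PMF ℕ} {R : DispatchRule N}

/-- Linearity in the initial law reduces all estimates to deterministic starts, where finite support
makes every moment finite. -/
lemma stateLaw_eq_bind (R : DispatchRule N) (arr : PMF ℕ) (svc : Fin N → PMF ℕ)
    (init : PMF (State N)) (t : ℕ) :
    stateLaw R arr svc init t = init.bind fun z => stateLaw R arr svc (PMF.pure z) t := by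
  induction t with
  | zero => simp [stateLaw]
  | succ t ih => simp only [stateLaw]; rw [ih, PMF.bind_bind]

lemma queueLaw_eq_bind (R : DispatchRule N) (arr : PMF ℕ) (svc : Fin N → PMF ℕ)
    (init : PMF (State N)) :
    queueLaw R arr svc init = fun t => init.bind fun z => queueLaw R arr svc (PMF.pure z) t := by
  funext t
  simp only [queueLaw]
  rw [stateLaw_eq_bind, PMF.map_bind]

lemma mem_support_stepLaw {t : ℕ} {z z' : State N} (h : z' ∈ (stepLaw R arr svc t z).support) :
    ∃ a ∈ arr.support, ∃ s ∈ (serviceLaw svc).support, ∃ n ∈ (R.dispatch t z).support,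
      ∃ m ∈ (R.update t z n a s).support, z' = (nextQueue z.1 n a s, m) := by
  simp only [stepLaw, PMF.mem_support_bind_iff, PMF.mem_support_map_iff] at h
  obtain ⟨a, ha, s, hs, n, hn, m, hm, h⟩ := h
  exact ⟨a, ha, s, hs, n, hn, m, hm, h.symm⟩

lemma stateLaw_support_subset {z : State N} (hz : z ∈ R.states 0) (t : ℕ) :
    (stateLaw R arr svc (PMF.pure z) t).support ⊆ R.states t := by
  induction t with
  | zero => simpa [stateLaw] using hz
  | succ t ih =>
    intro y hy
    simp only [stateLaw, PMF.mem_support_bind_iff] at hy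
    obtain ⟨x, hx, hy⟩ := hy
    obtain ⟨a, -, s, -, n, hn, m, hm, rfl⟩ := mem_support_stepLaw hy
    exact R.states_closed t x (ih hx) n hn a s m hm

variable {A S : ℕ} (hB : PrimBounded arr svc A S)
include hB

lemma finite_support_stepLaw (t : ℕ) (z : State N) : (stepLaw R arr svc t z).support.Finite :=
  PMF.finite_support_bind hB.arr_le.finite_support fun _ _ =>
    PMF.finite_support_bind (finite_support_serviceLaw hB.svc_le) fun _ _ =>
      PMF.finite_support_bind (Set.toFinite _) fun _ _ =>
        PMF.finite_support_map (Set.toFinite _) _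

lemma finite_support_stateLaw (z : State N) (t : ℕ) :
    (stateLaw R arr svc (PMF.pure z) t).support.Finite := by
  induction t with
  | zero => simp [stateLaw]
  | succ t ih => exact PMF.finite_support_bind ih fun x _ => finite_support_stepLaw hB t x

lemma finite_support_queueLaw (z : State N) (t : ℕ) :
    (queueLaw R arr svc (PMF.pure z) t).support.Finite :=
  PMF.finite_support_map (finite_support_stateLaw hB z t) _

lemma pexp_queueLaw (z : State N) (t : ℕ) (g : (Fin N → ℕ) → ℝ) :
    pexp (queueLaw R arr svc (PMF.pure z) t) g =
      pexp (stateLaw R arr svc (PMF.pure z) t) fun x => g x.1 :=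
  pexp_map (finite_support_stateLaw hB z t) _ _

/-- A function of the queues alone does not see the new memory, so the update rule integrates out.
-/
lemma pexp_stepLaw (t : ℕ) (z : State N) (g : (Fin N → ℕ) → ℝ) :
    pexp (stepLaw R arr svc t z) (fun x => g x.1) =
      pexp (slotLaw arr svc (R.dispatch t z)) fun w => g (nextQueue z.1 w.2 w.1.1 w.1.2) := by
  have hs := finite_support_serviceLaw hB.svc_le
  have h3 : ∀ a s, ∀ n ∈ (R.dispatch t z).support,
      ((R.update t z n a s).map fun m => (nextQueue z.1 n a s, m)).support.Finite :=
    fun a s n _ => PMF.finite_support_map (Set.toFinite _) _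
  have h2 : ∀ a, ∀ s ∈ (serviceLaw svc).support, ((R.dispatch t z).bind fun n =>
      (R.update t z n a s).map fun m => (nextQueue z.1 n a s, m)).support.Finite :=
    fun a s _ => PMF.finite_support_bind (Set.toFinite _) (h3 a s)
  rw [hB.pexp_slotLaw, hB.pexp_primLaw, stepLaw,
    pexp_bind hB.arr_le.finite_support fun a _ => PMF.finite_support_bind hs (h2 a)]
  refine pexp_congr fun a _ => ?_
  rw [pexp_bind hs (h2 a)]
  refine pexp_congr fun s _ => ?_
  rw [pexp_bind (Set.toFinite _) (h3 a s)]
  refine pexp_congr fun n _ => ?_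
  rw [pexp_map (Set.toFinite _)]
  exact pexp_const (g (nextQueue z.1 n a s))

lemma abs_sub_le_of_mem_stepLaw {t : ℕ} {z z' : State N}
    (h : z' ∈ (stepLaw R arr svc t z).support) (i : Fin N) :
    |((z'.1 i : ℕ) : ℝ) - z.1 i| ≤ A + S := by
  obtain ⟨a, ha, s, hs, n, -, m, -, rfl⟩ := mem_support_stepLaw h
  exact abs_nextQueue_sub_le z.1 n (hB.arr_le a ha) (le_of_mem_support_serviceLaw hB.svc_le hs) i

variable {μ : Fin N → ℝ} {ε : ℝ} (hsvc : ∀ n, pmfMean (svc n) = μ n)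
  (harr : pmfMean arr = ∑ n, μ n - ε)
include hsvc harr

lemma pexp_sqQueue_stepLaw_le (t : ℕ) (z : State N) :
    pexp (stepLaw R arr svc t z) (fun x => sqQueue x.1) ≤ sqQueue z.1 +
      (2 * ((∑ n, μ n - ε) * ∑ i, (z.1 i : ℝ) * (R.dispatch t z i).toReal -
        ∑ i, (z.1 i : ℝ) * μ i) + N * ((A : ℝ) + S) ^ 2) := by
  have hf := hB.finite_slotLaw (R.dispatch t z)
  rw [pexp_stepLaw hB]
  refine (pexp_mono hf fun w hw => sqQueue_nextQueue_le z.1 w.2 (hB.of_mem_slotLaw hw).1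
    (hB.of_mem_slotLaw hw).2).trans_eq ?_
  rw [pexp_add hf, pexp_const, pexp_add hf, pexp_const, pexp_const_mul,
    hB.pexp_weighted_input _ fun i => (z.1 i : ℝ), harr]
  simp only [hsvc]

/-- The last term is the mean -ε of the net input multiplied by -2X/N; it is the adverse drift that
state space collapse has to overcome. -/
lemma pexp_devQueue_stepLaw_le (hN : 0 < N) (t : ℕ) (z : State N) :
    pexp (stepLaw R arr svc t z) (fun x => devQueue x.1) ≤ devQueue z.1 +
      (2 * ((∑ n, μ n - ε) * ∑ i, (z.1 i : ℝ) * (R.dispatch t z i).toReal -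
        ∑ i, (z.1 i : ℝ) * μ i) + N * ((A : ℝ) + S) ^ 2 + 2 * ε * (totalQueue z.1 / N)) := by
  have hf := hB.finite_slotLaw (R.dispatch t z)
  rw [pexp_stepLaw hB]
  refine (pexp_mono hf fun w hw => devQueue_nextQueue_le z.1 w.2 hN (hB.of_mem_slotLaw hw).1
    (hB.of_mem_slotLaw hw).2).trans_eq ?_
  rw [pexp_add hf, pexp_const, pexp_add hf, pexp_add hf, pexp_const, pexp_const_mul,
    pexp_const_mul, hB.pexp_weighted_input _ fun i => (z.1 i : ℝ),
    hB.pexp_slotLaw_fst _ (fun w => (w.1 : ℝ) - ∑ n, (w.2 n : ℝ)), hB.pexp_net_input, harr]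
  simp only [hsvc]
  ring

lemma stepLaw_total_bounds (hN : 0 < N) (hε : 0 < ε) (t : ℕ) (z : State N) :
    -((N * S : ℝ) * (pexp (stepLaw R arr svc t z) (fun x => totalQueue x.1) -
        totalQueue z.1 + ε)) ≤
      pexp (stepLaw R arr svc t z) (fun x => totalQueue x.1 ^ 2) - totalQueue z.1 ^ 2 +
        2 * ε * totalQueue z.1 -
          pexp (primLaw arr svc) (fun w => ((w.1 : ℝ) - ∑ n, (w.2 n : ℝ)) ^ 2) ∧
      pexp (stepLaw R arr svc t z) (fun x => totalQueue x.1 ^ 2) - totalQueue z.1 ^ 2 +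
        2 * ε * totalQueue z.1 -
          pexp (primLaw arr svc) (fun w => ((w.1 : ℝ) - ∑ n, (w.2 n : ℝ)) ^ 2) ≤
      √ε * (N ^ 2 : ℝ) * pexp (stepLaw R arr svc t z) (fun x => devQueue x.1) +
        (N * S : ℝ) / √ε * (pexp (stepLaw R arr svc t z) (fun x => totalQueue x.1) -
          totalQueue z.1 + ε) := by
  have hf := hB.finite_slotLaw (R.dispatch t z)
  have hy : pexp (slotLaw arr svc (R.dispatch t z))
      (fun w => (w.1.1 : ℝ) - ∑ n, (w.1.2 n : ℝ)) = -ε := by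
    rw [hB.pexp_slotLaw_fst _ (fun w => (w.1 : ℝ) - ∑ n, (w.2 n : ℝ)), hB.pexp_net_input, harr]
    simp only [hsvc]
    ring
  have h := pexp_total_sq_bounds hf
    (X' := fun w => totalQueue (nextQueue z.1 w.2 w.1.1 w.1.2))
    (v := fun w => (N : ℝ) ^ 2 * devQueue (nextQueue z.1 w.2 w.1.1 w.1.2))
    (x := totalQueue z.1) (M := N * S) hε (fun w => totalQueue_nonneg _)
    (fun w => mul_nonneg (sq_nonneg _) (devQueue_nonneg _))
    (fun w hw => unused_service_bounds z.1 w.2 hN (hB.of_mem_slotLaw hw).2 rfl) hy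
  rw [pexp_const_mul, hB.pexp_slotLaw_fst _ (fun w => ((w.1 : ℝ) - ∑ n, (w.2 n : ℝ)) ^ 2),
    ← mul_assoc] at h
  rw [pexp_stepLaw hB t z devQueue, pexp_stepLaw hB t z totalQueue,
    pexp_stepLaw hB t z fun q => totalQueue q ^ 2]
  exact h

end chain

/-- Second moments of the queue lengths are eventually bounded, uniformly in the initial state. -/
lemma exists_sqQueue_bound {N : ℕ} {arr : PMF ℕ} {svc : Fin N → PMF ℕ} {A S : ℕ} {μ : Fin N → ℝ}
    {ε : ℝ} (hB : PrimBounded arr svc A S) (hN : 0 < N) (hμ : ∀ n, 0 < μ n) (hε : 0 < ε)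
    (hsvc : ∀ n, pmfMean (svc n) = μ n) (harr : pmfMean arr = ∑ n, μ n - ε) (R : DispatchRule N)
    (hR : ∀ t, ∀ z ∈ R.states t, HoldsUpToEquiv (IsTilted μ) z.1 (R.dispatch t z)) :
    ∃ C : ℝ, 0 ≤ C ∧ ∀ z ∈ R.states 0, ∀ᶠ t in atTop,
      pexp (stateLaw R arr svc (PMF.pure z) t) (fun x => sqQueue x.1) ≤ C := by
  have : Nonempty (Fin N) := ⟨⟨0, hN⟩⟩
  have hpos : 0 < ∑ n, μ n := Finset.sum_pos (fun i _ => hμ i) Finset.univ_nonempty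
  obtain ⟨n₀, hn₀⟩ := Finite.exists_min μ
  -- From ∑ q_i μ_i ≥ μ_min X ≥ μ_min ‖Q‖.
  set d := 2 * ε * μ n₀ / ∑ n, μ n with hd
  have hd0 : 0 < d := by have := hμ n₀; positivity
  have hmean : 0 ≤ ∑ n, μ n - ε := by
    rw [← harr]; exact integral_nonneg fun k => Nat.cast_nonneg k
  -- Here every slot has negative drift, so windows of length one suffice; the summand 1 in `M`
  -- keeps it positive when A = S = 0.
  obtain ⟨C, hC0, hC⟩ := exists_second_moment_bound 1 one_pos (M := N * ((A : ℝ) + S) + 1)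
    (K := N * ((A : ℝ) + S) ^ 2) (d₁ := 0) (d₂ := d) (by positivity) (by positivity) le_rfl
    (by simpa using hd0)
  refine ⟨C, hC0, fun z hz => ?_⟩
  have hsq : ∀ x : State N, √(sqQueue x.1) ^ 2 = sqQueue x.1 := fun x =>
    Real.sq_sqrt (sqQueue_nonneg _)
  have hdrift : ∀ t, ∀ x ∈ (stateLaw R arr svc (PMF.pure z) t).support,
      pexp (stepLaw R arr svc t x) (fun x' => √(sqQueue x'.1) ^ 2) - √(sqQueue x.1) ^ 2 ≤
        -d * √(sqQueue x.1) + N * ((A : ℝ) + S) ^ 2 := by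
    intro t x hx
    simp only [hsq]
    have h1 := pexp_sqQueue_stepLaw_le hB hsvc harr (R := R) t x
    have h2 := (hR t x (stateLaw_support_subset hz t hx)).sum_le hpos.ne'
    have h3 := mul_le_mul_of_nonneg_left h2 hmean
    have h4 : (∑ n, μ n - ε) * ((∑ i, (x.1 i : ℝ) * μ i) / ∑ i, μ i) =
        ∑ i, (x.1 i : ℝ) * μ i - ε * ((∑ i, (x.1 i : ℝ) * μ i) / ∑ i, μ i) := by
      field_simp
    have h5 : totalQueue x.1 * μ n₀ ≤ ∑ i, (x.1 i : ℝ) * μ i := by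
      rw [totalQueue, Finset.sum_mul]
      exact Finset.sum_le_sum fun i _ => mul_le_mul_of_nonneg_left (hn₀ i) (Nat.cast_nonneg _)
    have h6 : √(sqQueue x.1) * μ n₀ ≤ ∑ i, (x.1 i : ℝ) * μ i :=
      (mul_le_mul_of_nonneg_right (sqrt_sqQueue_le _) (hμ n₀).le).trans h5
    have h7 : d * √(sqQueue x.1) ≤ 2 * (ε * ((∑ i, (x.1 i : ℝ) * μ i) / ∑ i, μ i)) := by
      have : d * √(sqQueue x.1) = 2 * (ε * ((√(sqQueue x.1) * μ n₀) / ∑ i, μ i)) := by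
        rw [hd]; ring
      rw [this]
      gcongr
    linarith
  have := hC (stateLaw R arr svc (PMF.pure z)) (stepLaw R arr svc) (fun x => √(sqQueue x.1))
    (fun t => rfl) (finite_support_stateLaw hB z) (fun x => Real.sqrt_nonneg _)
    (fun t x _ x' hx' => (abs_sqrt_sqQueue_sub_le x.1 x'.1 (by positivity)
      (abs_sub_le_of_mem_stepLaw hB hx')).trans (by linarith))
    (fun t x hx => (hdrift t x hx).trans (by nlinarith [Real.sqrt_nonneg (sqQueue x.1)]))
    (fun j => ⟨j, by omega, by omega, hdrift j⟩)
  simpa only [hsq] using this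

/-- State space collapse: the expected squared distance from the diagonal is eventually bounded,
uniformly in the initial state and in all small `ε`. -/
lemma exists_devQueue_bound {N : ℕ} {μ : Fin N → ℝ} (hN : 0 < N) (hμ : ∀ n, 0 < μ n) (A S : ℕ)
    {T : ℕ} (hT : 0 < T) {δ : ℝ} (hδ : 0 < δ) :
    ∃ ε₁ > 0, ∃ C : ℝ, 0 ≤ C ∧ ∀ ε, 0 < ε → ε < ε₁ →
      ∀ (arr : PMF ℕ) (svc : Fin N → PMF ℕ), PrimBounded arr svc A S →
      (∀ n, pmfMean (svc n) = μ n) → pmfMean arr = ∑ n, μ n - ε → ∀ R : DispatchRule N,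
      (∀ t, ∀ z ∈ R.states t, HoldsUpToEquiv (IsTilted μ) z.1 (R.dispatch t z)) →
      (∀ k : ℕ, ∃ t, k * T ≤ t ∧ t < (k + 1) * T ∧ ∀ z ∈ R.states t,
        HoldsUpToEquiv (IsDeltaTilted μ δ) z.1 (R.dispatch t z)) →
      ∀ z ∈ R.states 0, ∀ᶠ t in atTop,
        pexp (stateLaw R arr svc (PMF.pure z) t) (fun x => devQueue x.1) ≤ C := by
  have : Nonempty (Fin N) := ⟨⟨0, hN⟩⟩
  have hpos : 0 < ∑ n, μ n := Finset.sum_pos (fun i _ => hμ i) Finset.univ_nonempty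
  have hN' : (0 : ℝ) < N := by positivity
  -- Coefficient of ‖Q_⊥‖ gained in a δ-tilted slot once the arrival rate is at least μ_Σ / 2, which
  -- the first entry of `ε₁` ensures.
  set η := (∑ n, μ n) * δ / N with hη
  have hη0 : 0 < η := by positivity
  -- The second entry makes 2 ε₁ (T + 1) ≤ η / 2, so that T slots with drift 2 ε₁ lose against one
  -- with drift -(η - 2 ε₁).
  set ε₁ := min ((∑ n, μ n) / 2) (η / (4 * (T + 1))) with hε₁
  have hε₁0 : 0 < ε₁ := lt_min (by positivity) (by positivity)
  have hε₁T : ε₁ * (4 * (T + 1)) ≤ η := (le_div_iff₀ (by positivity)).1 (min_le_right _ _)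
  obtain ⟨C, hC0, hC⟩ := exists_second_moment_bound T hT (M := N * (2 * ((A : ℝ) + S)) + 1)
    (K := N * ((A : ℝ) + S) ^ 2) (d₁ := 2 * ε₁) (d₂ := η - 2 * ε₁) (by positivity) (by positivity)
    (by positivity) (by nlinarith)
  refine ⟨ε₁, hε₁0, C, hC0, fun ε hε hεlt arr svc hB hsvc harr R hR hRδ z hz => ?_⟩
  have hmean : (∑ n, μ n) / 2 ≤ ∑ n, μ n - ε := by
    have : ε < (∑ n, μ n) / 2 := hεlt.trans_le (min_le_left _ _)
    linarith
  have hmean0 : 0 ≤ ∑ n, μ n - ε := le_trans (by positivity) hmean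
  have hsq : ∀ x : State N, √(devQueue x.1) ^ 2 = devQueue x.1 := fun x =>
    Real.sq_sqrt (devQueue_nonneg _)
  have hsplit : ∀ x : State N, (∑ n, μ n - ε) * ((∑ i, (x.1 i : ℝ) * μ i) / ∑ i, μ i) =
      ∑ i, (x.1 i : ℝ) * μ i - ε * ((∑ i, (x.1 i : ℝ) * μ i) / ∑ i, μ i) := by
    intro x
    field_simp
  -- The adverse term ε X / N is unbounded, but tilting already supplies -ε times the μ-weighted
  -- average, and the two averages differ by at most ‖Q_⊥‖.
  have hdev : ∀ x : State N, ε * (totalQueue x.1 / N) -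
      ε * ((∑ i, (x.1 i : ℝ) * μ i) / ∑ i, μ i) ≤ ε₁ * √(devQueue x.1) := by
    intro x
    rw [← mul_sub]
    exact (mul_le_mul_of_nonneg_left (average_sub_le hμ hN x.1) hε.le).trans
      (mul_le_mul_of_nonneg_right hεlt.le (Real.sqrt_nonneg _))
  have := hC (stateLaw R arr svc (PMF.pure z)) (stepLaw R arr svc) (fun x => √(devQueue x.1))
    (fun t => rfl) (finite_support_stateLaw hB z) (fun x => Real.sqrt_nonneg _)
    (fun t x _ x' hx' => (abs_sqrt_devQueue_sub_le hN x.1 x'.1 (by positivity)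
      (abs_sub_le_of_mem_stepLaw hB hx')).trans (by linarith))
    (fun t x hx => ?_) (fun j => ?_)
  · simpa only [hsq] using this
  · simp only [hsq]
    have h1 := pexp_devQueue_stepLaw_le hB hsvc harr hN (R := R) t x
    have h2 := (hR t x (stateLaw_support_subset hz t hx)).sum_le hpos.ne'
    have h3 := mul_le_mul_of_nonneg_left h2 hmean0
    rw [hsplit] at h3
    linarith [hdev x]
  · obtain ⟨t, ht1, ht2, ht⟩ := hRδ j
    refine ⟨t, ht1, ht2, fun x hx => ?_⟩
    simp only [hsq]
    have h1 := pexp_devQueue_stepLaw_le hB hsvc harr hN (R := R) t x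
    have h2 := (ht x (stateLaw_support_subset hz t hx)).sum_le_of_delta hpos.ne' hδ.le
    have h3 := mul_le_mul_of_nonneg_left h2 hmean0
    rw [mul_sub, hsplit] at h3
    have h4 : η * √(devQueue x.1) ≤ 2 * ((∑ n, μ n - ε) * (δ / N * √(devQueue x.1))) := by
      have h5 : 0 ≤ δ / N * √(devQueue x.1) := by positivity
      have h6 := mul_le_mul_of_nonneg_right hmean h5
      have h7 : η * √(devQueue x.1) = 2 * ((∑ n, μ n) / 2 * (δ / N * √(devQueue x.1))) := by
        rw [hη]; ring
      linarith
    linarith [hdev x]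

/-! ### The resource-pooled queue -/

section pooled
variable {N : ℕ} {arr : PMF ℕ} {svc : Fin N → PMF ℕ}

/-- One slot of the resource-pooled queue. -/
noncomputable def pooledStep (arr : PMF ℕ) (svc : Fin N → PMF ℕ) (q : ℕ) : PMF ℕ :=
  arr.bind fun a => (serviceLaw svc).map fun s => q + a - ∑ n, s n

lemma pooledLaw_succ (init : PMF ℕ) (t : ℕ) :
    pooledLaw arr svc init (t + 1) = (pooledLaw arr svc init t).bind (pooledStep arr svc) := rfl

lemma pooledStep_eq_map (q : ℕ) :
    pooledStep arr svc q = (primLaw arr svc).map fun w => q + w.1 - ∑ n, w.2 n := by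
  simp only [pooledStep, primLaw, PMF.map_bind, PMF.map_comp]
  rfl

lemma pooledLaw_eq_bind (arr : PMF ℕ) (svc : Fin N → PMF ℕ) (init : PMF ℕ) :
    pooledLaw arr svc init = fun t => init.bind fun q => pooledLaw arr svc (PMF.pure q) t := by
  funext t
  induction t with
  | zero => simp [pooledLaw]
  | succ t ih => simp only [pooledLaw_succ]; rw [ih, PMF.bind_bind]

lemma pooled_cast (q a s : ℕ) : ((q + a - s : ℕ) : ℝ) = max ((q : ℝ) + ((a : ℝ) - s)) 0 := by
  rcases le_total s (q + a) with h | h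
  · rw [Nat.cast_sub h, max_eq_left]
    · push_cast; ring
    · have : (s : ℝ) ≤ q + a := by exact_mod_cast h
      linarith
  · rw [Nat.sub_eq_zero_of_le h, max_eq_right]
    · simp
    · have : (q : ℝ) + a ≤ s := by exact_mod_cast h
      linarith

variable {A S : ℕ} (hB : PrimBounded arr svc A S)
include hB

lemma finite_support_pooledLaw (q t : ℕ) :
    (pooledLaw arr svc (PMF.pure q) t).support.Finite := by
  induction t with
  | zero => simp [pooledLaw]
  | succ t ih =>
    rw [pooledLaw_succ]
    refine PMF.finite_support_bind ih fun x _ => ?_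
    rw [pooledStep_eq_map]
    exact PMF.finite_support_map hB.finite_primLaw _

lemma pexp_pooledStep (q : ℕ) (g : ℕ → ℝ) :
    pexp (pooledStep arr svc q) g = pexp (primLaw arr svc) fun w => g (q + w.1 - ∑ n, w.2 n) := by
  rw [pooledStep_eq_map, pexp_map hB.finite_primLaw]

lemma service_sum_le {w : ℕ × (Fin N → ℕ)} (hw : w ∈ (primLaw arr svc).support) :
    ((∑ n, w.2 n : ℕ) : ℝ) ≤ N * S := by
  have : ∑ n, w.2 n ≤ ∑ _n : Fin N, S := Finset.sum_le_sum fun n _ => (hB.of_mem_primLaw hw).2 n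
  simp only [Finset.sum_const, Finset.card_univ, Fintype.card_fin, smul_eq_mul] at this
  exact_mod_cast this

variable {μ : Fin N → ℝ} {ε : ℝ} (hε : 0 < ε) (hsvc : ∀ n, pmfMean (svc n) = μ n)
  (harr : pmfMean arr = ∑ n, μ n - ε)
include hε hsvc harr

/-- A single queue with unused service is empty afterwards, so the cross term vanishes and v = 0;
the zero term on the right matches the shape of `cesaro_total_bounds`. -/
lemma pooledStep_bounds (q : ℕ) :
    -((N * S : ℝ) * (pexp (pooledStep arr svc q) (fun x => (x : ℝ)) - q + ε)) ≤
      pexp (pooledStep arr svc q) (fun x => (x : ℝ) ^ 2) - (q : ℝ) ^ 2 + 2 * ε * q -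
        pexp (primLaw arr svc) (fun w => ((w.1 : ℝ) - ∑ n, (w.2 n : ℝ)) ^ 2) ∧
      pexp (pooledStep arr svc q) (fun x => (x : ℝ) ^ 2) - (q : ℝ) ^ 2 + 2 * ε * q -
        pexp (primLaw arr svc) (fun w => ((w.1 : ℝ) - ∑ n, (w.2 n : ℝ)) ^ 2) ≤
      √ε * 0 * pexp (pooledStep arr svc q) (fun _ => 0) +
        (N * S : ℝ) / √ε * (pexp (pooledStep arr svc q) (fun x => (x : ℝ)) - q + ε) := by
  have hy : pexp (primLaw arr svc) (fun w => (w.1 : ℝ) - ∑ n, (w.2 n : ℝ)) = -ε := by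
    rw [hB.pexp_net_input, harr]
    simp only [hsvc]
    ring
  have h := pexp_total_sq_bounds hB.finite_primLaw
    (X' := fun w => ((q + w.1 - ∑ n, w.2 n : ℕ) : ℝ)) (v := fun _ => 0) (x := q) (M := N * S) hε
    (fun w => Nat.cast_nonneg _) (fun w => le_rfl) (fun w hw => ?_) hy
  · simp only [pexp_pooledStep hB]
    rw [pexp_const] at h ⊢
    simpa using h
  · have hs := service_sum_le hB hw
    have hq : (0 : ℝ) ≤ q := Nat.cast_nonneg _
    have ha : (0 : ℝ) ≤ w.1 := Nat.cast_nonneg _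
    rw [← Nat.cast_sum, pooled_cast]
    set y := (q : ℝ) + ((w.1 : ℝ) - (∑ n, w.2 n : ℕ)) with hy
    rcases max_cases y 0 with ⟨h1, h2⟩ | ⟨h1, h2⟩ <;> rw [h1]
    · refine ⟨by linarith, ?_, fun h => absurd (by ring) h⟩
      rw [sub_self]; positivity
    · refine ⟨by linarith, by linarith, fun _ => by norm_num⟩

/-- Dropping the truncation bounds the drift of q² by -2εq + E[y²], which is negative outside a
bounded set in every slot. -/
lemma exists_pooled_bound : ∃ C : ℝ, 0 ≤ C ∧ ∀ q : ℕ, ∀ᶠ t in atTop,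
    pexp (pooledLaw arr svc (PMF.pure q) t) (fun x => (x : ℝ) ^ 2) ≤ C := by
  set G := pexp (primLaw arr svc) fun w => ((w.1 : ℝ) - ∑ n, (w.2 n : ℝ)) ^ 2 with hG
  have hG0 : 0 ≤ G := pexp_nonneg fun w => sq_nonneg _
  obtain ⟨C, hC0, hC⟩ := exists_second_moment_bound 1 one_pos (M := (A : ℝ) + N * S + 1)
    (K := G) (d₁ := 0) (d₂ := 2 * ε) (by positivity) hG0 le_rfl (by simpa using hε)
  have hy : pexp (primLaw arr svc) (fun w => (w.1 : ℝ) - ∑ n, (w.2 n : ℝ)) = -ε := by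
    rw [hB.pexp_net_input, harr]
    simp only [hsvc]
    ring
  have hdrift : ∀ q : ℕ, pexp (pooledStep arr svc q) (fun x => (x : ℝ) ^ 2) - (q : ℝ) ^ 2 ≤
      -(2 * ε) * q + G := by
    intro q
    have hf := hB.finite_primLaw
    have h1 : pexp (pooledStep arr svc q) (fun x => (x : ℝ) ^ 2) ≤
        pexp (primLaw arr svc) fun w => (q : ℝ) ^ 2 +
          (2 * q * ((w.1 : ℝ) - ∑ n, (w.2 n : ℝ)) + ((w.1 : ℝ) - ∑ n, (w.2 n : ℝ)) ^ 2) := by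
      rw [pexp_pooledStep hB]
      refine pexp_mono hf fun w _ => ?_
      rw [pooled_cast, Nat.cast_sum]
      set y := (w.1 : ℝ) - ∑ n, (w.2 n : ℝ)
      rcases max_cases ((q : ℝ) + y) 0 with ⟨h1, h2⟩ | ⟨h1, h2⟩ <;> rw [h1] <;>
        nlinarith [sq_nonneg ((q : ℝ) + y)]
    rw [pexp_add hf, pexp_add hf, pexp_const, pexp_const_mul, hy] at h1
    linarith
  refine ⟨C, hC0, fun q => hC (pooledLaw arr svc (PMF.pure q)) (fun _ => pooledStep arr svc)
    (fun x => (x : ℝ)) (fun t => rfl) (finite_support_pooledLaw hB q)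
    (fun x => Nat.cast_nonneg x) (fun t x _ x' hx' => ?_)
    (fun t x _ => (hdrift x).trans (by
      have : (0 : ℝ) ≤ x := Nat.cast_nonneg x
      nlinarith)) (fun j => ⟨j, by omega, by omega, fun x _ => hdrift x⟩)⟩
  rw [pooledStep_eq_map, PMF.mem_support_map_iff] at hx'
  obtain ⟨w, hw, rfl⟩ := hx'
  have hs := service_sum_le hB hw
  have ha : (w.1 : ℝ) ≤ A := by exact_mod_cast (hB.of_mem_primLaw hw).1
  have ha0 : (0 : ℝ) ≤ w.1 := Nat.cast_nonneg _
  have hs0 : (0 : ℝ) ≤ (∑ n, w.2 n : ℕ) := Nat.cast_nonneg _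
  have hx : (0 : ℝ) ≤ x := Nat.cast_nonneg _
  rw [pooled_cast, abs_le]
  rcases max_cases ((x : ℝ) + ((w.1 : ℝ) - (∑ n, w.2 n : ℕ))) 0 with ⟨h1, h2⟩ | ⟨h1, h2⟩ <;>
    rw [h1] <;> constructor <;> linarith

end pooled

/-! ### Throughput optimality and heavy-traffic delay optimality -/

section queue
variable {N : ℕ} {arr : PMF ℕ} {svc : Fin N → PMF ℕ} {A S : ℕ} {R : DispatchRule N}

lemma pexp_totalQueue_sq_le (hB : PrimBounded arr svc A S) {C : ℝ} {z : State N}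
    (h : ∀ᶠ t in atTop, pexp (stateLaw R arr svc (PMF.pure z) t) (fun x => sqQueue x.1) ≤ C) :
    ∀ᶠ t in atTop, pexp (queueLaw R arr svc (PMF.pure z) t) (fun q => totalQueue q ^ 2) ≤
      N * C := by
  filter_upwards [h] with t ht
  rw [pexp_queueLaw hB]
  refine (pexp_mono (finite_support_stateLaw hB z t) fun x _ => totalQueue_sq_le x.1).trans ?_
  rw [pexp_const_mul]
  exact mul_le_mul_of_nonneg_left ht (Nat.cast_nonneg N)

end queue

lemma pexp_le_of_sq {α : Type*} {p : PMF α} (hp : p.support.Finite) {f : α → ℝ} {C : ℝ}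
    (h : pexp p (fun x => f x ^ 2) ≤ C) : pexp p f ≤ C + 1 := by
  have h1 : pexp p f ≤ pexp p fun x => f x ^ 2 + 1 :=
    pexp_mono hp fun x _ => by nlinarith [sq_nonneg (f x - 1)]
  rw [pexp_add hp, pexp_const] at h1
  linarith

section mixture
variable {ζ α : Type*} {init : PMF ζ} {L : ζ → ℕ → PMF α} {f : α → ℝ} {C : ℝ}

/-- A mixture of processes with eventually bounded second moments is tight. -/
lemma exists_mass_sublevel_of_sq (hf : ∀ x, 0 ≤ f x) (hfin : ∀ K : ℝ, {x | f x ≤ K}.Finite)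
    (hL : ∀ z ∈ init.support, ∀ t, (L z t).support.Finite)
    (hC : ∀ z ∈ init.support, ∀ᶠ t in atTop, pexp (L z t) (fun x => f x ^ 2) ≤ C) {η : ℝ}
    (hη : 0 < η) :
    ∃ K : ℝ, ∀ t, 1 - η ≤ ∑ x ∈ (hfin K).toFinset, ((init.bind (L · t)) x).toReal := by
  refine exists_mass_sublevel hf hfin hL (fun z hz => ?_) hη
  obtain ⟨r, -, hr⟩ := exists_bound_of_eventually_le (hC z hz)
  exact ⟨r + 1, fun t => pexp_le_of_sq (hL z hz t) (hr t)⟩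

variable [Countable α]

lemma exists_isSteadyState_of_sq (hf : ∀ x, 0 ≤ f x) (hfin : ∀ K : ℝ, {x | f x ≤ K}.Finite)
    (hL : ∀ z ∈ init.support, ∀ t, (L z t).support.Finite)
    (hC : ∀ z ∈ init.support, ∀ᶠ t in atTop, pexp (L z t) (fun x => f x ^ 2) ≤ C) :
    ∃ π, IsSteadyState (fun t => init.bind (L · t)) π :=
  exists_isSteadyState_of_tight fun _ hη =>
    (exists_mass_sublevel_of_sq hf hfin hL hC hη).elim fun K hK => ⟨(hfin K).toFinset, hK⟩

variable [MeasurableSpace α] [MeasurableSingletonClass α]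

lemma integrable_of_isSteadyState_of_sq (hf : ∀ x, 0 ≤ f x)
    (hL : ∀ z ∈ init.support, ∀ t, (L z t).support.Finite) (hC0 : 0 ≤ C)
    (hC : ∀ z ∈ init.support, ∀ᶠ t in atTop, pexp (L z t) (fun x => f x ^ 2) ≤ C)
    {π : PMF α} (hπ : IsSteadyState (fun t => init.bind (L · t)) π) : Integrable f π.toMeasure := by
  refine (integral_le_of_isSteadyState (C := C + 1) hf hL (by positivity) (fun z hz η hη => ?_)
    hπ).1
  refine cesaro_eventually_le ?_ hη
  filter_upwards [hC z hz] with t ht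
  exact pexp_le_of_sq (hL z hz t) ht

lemma integral_mem_Icc_of_isSteadyState (hf : ∀ x, 0 ≤ f x) (hfin : ∀ K : ℝ, {x | f x ≤ K}.Finite)
    (hL : ∀ z ∈ init.support, ∀ t, (L z t).support.Finite)
    (hC : ∀ z ∈ init.support, ∀ᶠ t in atTop, pexp (L z t) (fun x => f x ^ 2) ≤ C)
    {l u : ℝ} (hu : 0 ≤ u)
    (hlu : ∀ z ∈ init.support, ∀ η > 0, ∀ᶠ n in atTop, l - η ≤ cesaro (fun t => pexp (L z t) f) n ∧
      cesaro (fun t => pexp (L z t) f) n ≤ u + η)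
    {π : PMF α} (hπ : IsSteadyState (fun t => init.bind (L · t)) π) :
    ∫ x, f x ∂π.toMeasure ∈ Set.Icc l u := by
  have hupp : ∀ z ∈ init.support, ∀ η > 0, ∀ᶠ n in atTop,
      cesaro (fun t => pexp (L z t) f) n ≤ u + η :=
    fun z hz η hη => (hlu z hz η hη).mono fun _ h => h.2
  refine ⟨?_, (integral_le_of_isSteadyState hf hL hu hupp hπ).2⟩
  refine le_integral_of_isSteadyState hf hfin hL (fun z hz => ?_)
    (fun z hz η hη => (hlu z hz η hη).mono fun _ h => h.1) hπ
    (sum_le_of_isSteadyState hf hL hu hupp hπ)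
  obtain ⟨r, -, hr⟩ := exists_bound_of_eventually_le (hC z hz)
  exact ⟨r, hr⟩

end mixture

/-- Some initial state is possible, and a tilted vector there requires a position k between 2 and N.
-/
lemma two_le_of_inClassPi {N : ℕ} {μ : Fin N → ℝ} {pol : Policy N} (hpol : InClassPi μ pol) :
    2 ≤ N := by
  obtain ⟨z, hz⟩ := (pol 1).states_nonempty
  exact (hpol.tilted 1 one_pos 0 z hz).two_le

lemma IsServiceProcess.exists_primBounded {N : ℕ} {μ : Fin N → ℝ} {svc : Fin N → PMF ℕ}
    (h : IsServiceProcess μ svc) :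
    ∃ S, ∀ (arr : PMF ℕ) (A : ℕ), BoundedBy arr A → PrimBounded arr svc A S := by
  obtain ⟨S, hS⟩ := h.bounded
  exact ⟨S, fun _ _ hA => ⟨hA, hS⟩⟩

theorem InClassPi.throughputOptimal {N : ℕ} {μ : Fin N → ℝ} (hμ : ∀ n, 0 < μ n) {pol : Policy N}
    (hpol : InClassPi μ pol) : ThroughputOptimal μ pol := by
  intro svc hsvc ε hε arr harr ⟨A, hA⟩ init hinit
  have hN : 0 < N := by have := two_le_of_inClassPi hpol; omega
  obtain ⟨S, hS⟩ := hsvc.exists_primBounded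
  have hB := hS arr A hA
  obtain ⟨C, -, hC⟩ := exists_sqQueue_bound hB hN hμ hε hsvc.mean_eq harr (pol ε)
    (hpol.tilted ε hε)
  refine isStable_of_tight finite_totalQueue_le fun η hη => ?_
  rw [queueLaw_eq_bind]
  exact exists_mass_sublevel_of_sq totalQueue_nonneg finite_totalQueue_le
    (fun z _ => finite_support_queueLaw hB z)
    (fun z hz => pexp_totalQueue_sq_le hB (hC z (hinit hz))) hη

/-- A mean between these two bounds has the heavy-traffic limit `g / 2`. -/
lemma tendsto_of_scaled_bounds {G m : ℝ → ℝ} {g M c ε₁ : ℝ} (hε₁ : 0 < ε₁)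
    (hG : Tendsto G (𝓝[>] 0) (𝓝 g))
    (hm : ∀ ε ∈ Set.Ioo 0 ε₁,
      m ε ∈ Set.Icc ((G ε - M * ε) / (2 * ε)) ((G ε + √ε * (c + M)) / (2 * ε))) :
    Tendsto (fun ε => ε * m ε) (𝓝[>] 0) (𝓝 (g / 2)) := by
  have hid : Tendsto (fun ε : ℝ => ε) (𝓝[>] 0) (𝓝 0) := tendsto_nhdsWithin_of_tendsto_nhds tendsto_id
  have hsqrt : Tendsto (fun ε : ℝ => √ε) (𝓝[>] 0) (𝓝 0) := by
    have := (Real.continuous_sqrt.tendsto 0).comp hid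
    simpa [Function.comp_def] using this
  have hl : Tendsto (fun ε => (G ε - M * ε) / 2) (𝓝[>] 0) (𝓝 (g / 2)) := by
    have := (hG.sub (hid.const_mul M)).div_const 2
    simpa using this
  have hu : Tendsto (fun ε => (G ε + √ε * (c + M)) / 2) (𝓝[>] 0) (𝓝 (g / 2)) := by
    have := (hG.add (hsqrt.mul_const (c + M))).div_const 2
    simpa using this
  have hmem : ∀ᶠ ε in 𝓝[>] (0 : ℝ), ε ∈ Set.Ioo 0 ε₁ := Ioo_mem_nhdsGT hε₁
  refine tendsto_of_tendsto_of_tendsto_of_le_of_le' hl hu ?_ ?_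
  · filter_upwards [hmem] with ε hε
    have h1 := mul_le_mul_of_nonneg_left (hm ε hε).1 hε.1.le
    refine le_trans (le_of_eq ?_) h1
    have := hε.1.ne'
    field_simp
  · filter_upwards [hmem] with ε hε
    have h1 := mul_le_mul_of_nonneg_left (hm ε hε).2 hε.1.le
    refine h1.trans (le_of_eq ?_)
    have := hε.1.ne'
    field_simp

theorem InClassPi.heavyTrafficDelayOptimal {N : ℕ} {μ : Fin N → ℝ} (hμ : ∀ n, 0 < μ n)
    {pol : Policy N} (hpol : InClassPi μ pol) : HeavyTrafficDelayOptimal μ pol := by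
  intro svc hsvc ε₀ arr A σsq hε₀ hmean hbdd hvar init init' hinit
  have hN : 0 < N := by have := two_le_of_inClassPi hpol; omega
  obtain ⟨S, hS⟩ := hsvc.exists_primBounded
  have hB : ∀ ε ∈ Set.Ioo 0 ε₀, PrimBounded (arr ε) svc A S := fun ε hε => hS _ _ (hbdd ε hε)
  obtain ⟨T, hT, δ, hδ, hwin⟩ := hpol.deltaTilted
  have hqueue : ∀ ε ∈ Set.Ioo 0 ε₀, ∃ C : ℝ, 0 ≤ C ∧ ∀ z ∈ (init ε).support, ∀ᶠ t in atTop,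
      pexp (queueLaw (pol ε) (arr ε) svc (PMF.pure z) t) (fun q => totalQueue q ^ 2) ≤ C := by
    intro ε hε
    obtain ⟨C, hC0, hC⟩ := exists_sqQueue_bound (hB ε hε) hN hμ hε.1 hsvc.mean_eq (hmean ε hε)
      (pol ε) (hpol.tilted ε hε.1)
    exact ⟨N * C, by positivity, fun z hz =>
      pexp_totalQueue_sq_le (hB ε hε) (hC z (hinit ε hε hz))⟩
  have hpooled : ∀ ε ∈ Set.Ioo 0 ε₀, ∃ C : ℝ, 0 ≤ C ∧ ∀ q : ℕ, ∀ᶠ t in atTop,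
      pexp (pooledLaw (arr ε) svc (PMF.pure q) t) (fun x => (x : ℝ) ^ 2) ≤ C := fun ε hε =>
    exists_pooled_bound (hB ε hε) hε.1 hsvc.mean_eq (hmean ε hε)
  have hfinq : ∀ ε ∈ Set.Ioo 0 ε₀, ∀ z ∈ (init ε).support, ∀ t,
      (queueLaw (pol ε) (arr ε) svc (PMF.pure z) t).support.Finite :=
    fun ε hε z _ => finite_support_queueLaw (hB ε hε) z
  have hfinp : ∀ ε ∈ Set.Ioo 0 ε₀, ∀ q ∈ (init' ε).support, ∀ t,
      (pooledLaw (arr ε) svc (PMF.pure q) t).support.Finite :=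
    fun ε hε q _ => finite_support_pooledLaw (hB ε hε) q
  have hfinN : ∀ K : ℝ, {x : ℕ | (x : ℝ) ≤ K}.Finite := fun K =>
    (Set.finite_Iic ⌊K⌋₊).subset fun x hx => Nat.le_floor hx
  have hnn : ∀ x : ℕ, (0 : ℝ) ≤ x := fun x => Nat.cast_nonneg x
  refine ⟨fun ε hε => ⟨?_, ?_⟩, fun π π' hπ hπ' => ⟨fun ε hε => ⟨?_, ?_⟩, ?_⟩⟩
  · obtain ⟨C, -, hC⟩ := hqueue ε hε
    rw [queueLaw_eq_bind]
    exact exists_isSteadyState_of_sq totalQueue_nonneg finite_totalQueue_le (hfinq ε hε) hC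
  · obtain ⟨C, -, hC⟩ := hpooled ε hε
    rw [pooledLaw_eq_bind]
    exact exists_isSteadyState_of_sq hnn hfinN (hfinp ε hε) fun q _ => hC q
  · obtain ⟨C, hC0, hC⟩ := hqueue ε hε
    have h := hπ ε hε
    rw [queueLaw_eq_bind] at h
    exact integrable_of_isSteadyState_of_sq totalQueue_nonneg (hfinq ε hε) hC0 hC h
  · obtain ⟨C, hC0, hC⟩ := hpooled ε hε
    have h := hπ' ε hε
    rw [pooledLaw_eq_bind] at h
    exact integrable_of_isSteadyState_of_sq hnn (hfinp ε hε) hC0 (fun q _ => hC q) h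
  obtain ⟨ε₁, hε₁, Cv, hCv0, hCv⟩ := exists_devQueue_bound hN hμ A S hT hδ
  set G : ℝ → ℝ := fun ε =>
    pexp (primLaw (arr ε) svc) fun w => ((w.1 : ℝ) - ∑ n, (w.2 n : ℝ)) ^ 2 with hG
  have hG0 : ∀ ε, 0 ≤ G ε := fun ε => pexp_nonneg fun w => sq_nonneg _
  set m := ∑ n, μ n with hm
  set s₂ := pexp (serviceLaw svc) fun s => (∑ n, (s n : ℝ)) ^ 2 with hs₂
  -- Since the total service has mean m, the limit is the sum of the limiting arrival variance and
  -- the variance of the total service.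
  have hGlim : Tendsto G (𝓝[>] 0) (𝓝 (σsq + m ^ 2 - 2 * m * m + s₂)) := by
    have hid : Tendsto (fun ε : ℝ => m - ε) (𝓝[>] 0) (𝓝 m) := by
      have : Tendsto (fun ε : ℝ => m - ε) (𝓝 0) (𝓝 (m - 0)) := tendsto_const_nhds.sub tendsto_id
      rw [sub_zero] at this
      exact tendsto_nhdsWithin_of_tendsto_nhds this
    refine (((hvar.add (hid.pow 2)).sub ((hid.const_mul 2).mul_const m)).add_const s₂).congr' ?_
    have hmem : ∀ᶠ ε in 𝓝[>] (0 : ℝ), ε ∈ Set.Ioo 0 ε₀ := Ioo_mem_nhdsGT hε₀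
    filter_upwards [hmem] with ε hε
    have h := (hB ε hε).pexp_net_input_sq
    simp only [hsvc.mean_eq] at h
    rw [hG, hm]
    simp only
    rw [h, hmean ε hε]
  refine ⟨(σsq + m ^ 2 - 2 * m * m + s₂) / 2, ?_, ?_⟩
  · refine tendsto_of_scaled_bounds (M := N * S) (c := (N : ℝ) ^ 2 * Cv) (lt_min hε₀ hε₁) hGlim
      fun ε hε => ?_
    have hε' : ε ∈ Set.Ioo 0 ε₀ := ⟨hε.1, hε.2.trans_le (min_le_left _ _)⟩
    obtain ⟨C, hC0, hC⟩ := hqueue ε hε'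
    have h := hπ ε hε'
    rw [queueLaw_eq_bind] at h
    -- The bound `hC` may depend on ε, since it serves only to exclude loss of mean at infinity; the
    -- quantitative bounds use the uniform constant `Cv`.
    refine integral_mem_Icc_of_isSteadyState totalQueue_nonneg finite_totalQueue_le (hfinq ε hε') hC
      (div_nonneg (add_nonneg (hG0 ε) (by positivity)) (by linarith [hε.1])) (fun z hz => ?_) h
    simp only [pexp_queueLaw (hB ε hε')] at hC ⊢
    obtain ⟨r, -, hr⟩ := exists_bound_of_eventually_le (hC z hz)
    exact cesaro_total_bounds (p := stateLaw (pol ε) (arr ε) svc (PMF.pure z))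
      (k := stepLaw (pol ε) (arr ε) svc) (V := fun x => devQueue x.1) (fun t => rfl)
      (finite_support_stateLaw (hB ε hε') z) (fun x => totalQueue_nonneg x.1) hε.1
      (by positivity) (by positivity) hr
      (hCv ε hε.1 (hε.2.trans_le (min_le_right _ _)) (arr ε) svc (hB ε hε') hsvc.mean_eq
        (hmean ε hε') (pol ε) (hpol.tilted ε hε.1) (hwin ε hε.1) z (hinit ε hε' hz))
      (fun t x _ => stepLaw_total_bounds (hB ε hε') hsvc.mean_eq (hmean ε hε') hN hε.1 t x)
  · refine tendsto_of_scaled_bounds (M := N * S) (c := 0) hε₀ hGlim fun ε hε => ?_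
    obtain ⟨C, hC0, hC⟩ := hpooled ε hε
    have h := hπ' ε hε
    rw [pooledLaw_eq_bind] at h
    refine integral_mem_Icc_of_isSteadyState hnn hfinN (hfinp ε hε) (fun q _ => hC q)
      (div_nonneg (add_nonneg (hG0 ε) (by positivity)) (by linarith [hε.1])) (fun z hz => ?_) h
    obtain ⟨r, -, hr⟩ := exists_bound_of_eventually_le (hC z)
    have := cesaro_total_bounds (p := pooledLaw (arr ε) svc (PMF.pure z))
      (k := fun _ => pooledStep (arr ε) svc) (X := fun x => (x : ℝ)) (V := fun _ => 0) (c := 0)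
      (Cv := 0) (fun t => rfl) (finite_support_pooledLaw (hB ε hε) z) hnn hε.1
      (by positivity) le_rfl hr (Eventually.of_forall fun t => (pexp_const 0).le)
      (fun t x _ => pooledStep_bounds (hB ε hε) hε.1 hsvc.mean_eq (hmean ε hε) x)
    simpa only [mul_zero] using this

theorem theorem1 (N : ℕ) (μ : Fin N → ℝ) (hμ : ∀ n, 0 < μ n) (pol : Policy N)
    (hpol : InClassPi μ pol) :
    ThroughputOptimal μ pol ∧ HeavyTrafficDelayOptimal μ pol :=
  ⟨hpol.throughputOptimal hμ, hpol.heavyTrafficDelayOptimal hμ⟩
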